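/- All rings are commutative with $1$. A \emph{poring} is a ring $A$ with a partial order, compatible with addition and multiplication, in which all squares are $\ge 0$; $A^+=\{a\in A: a\ge 0\}$ (for a ring without a specified order, $A^+$ is the set of sums of squares). A ring is \emph{real} if $\sum a_i^2=0$ implies that all $a_i=0$; it is \emph{von Neumann regular} if for every $a$ there is $b$ with $a^2b=a$; it is \emph{Baer} if the annihilator of every subset is generated by an idempotent. An extension $A\subseteq B$ is \emph{essential} if every nonzero ideal of $B$ meets $A$ in a nonzero ideal. A real ring $C$ is \emph{real closed $*$} if it has no proper real extension that is integral and essential over $C$. A \emph{real closure $*$} of a poring $A$ is a real closed $*$ ring $C$ that is an integral and essential extension of $A$ and an extension of porings (that is, $C$ has a poring order with $A^+\subseteq C^+$). A \emph{prime cone} of a ring $A$ is a set $\alpha\subseteq A$ closed under addition and multiplication with $\alpha\cup-\alpha=A$ such that $\operatorname{supp}\alpha=\alpha\cap-\alpha$ is a prime ideal. For a poring $A$, $\operatorname{Sper}A$ is the set of prime cones containing $A^+$, with the topology generated by the sets $P(x)=\{\alpha : x\in\alpha\setminus\operatorname{supp}\alpha\}$, $x\in A$. For a prime cone $\alpha$,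 $\rho(\alpha)$ denotes a real closed field that is algebraic over the fraction field of $A/\operatorname{supp}\alpha$ and in which the image of $\alpha$ is nonnegative. \textbf{Theorem.} Let $A$ be a real Baer von Neumann regular poring. Let $\mathcal S$ be the set of continuous maps $s:\operatorname{Spec}A\to\operatorname{Sper}A$ with $\operatorname{supp}\circ s=\mathrm{id}$, and let $\mathcal C$ be the set of real closures $*$ of $A$ up to $A$-isomorphism. Then there is a bijection $\Phi:\mathcal S\to\mathcal C$ with the following property. Let $s\in\mathcal S$. Then the fields $\rho(s(\mathfrak p))$, $\mathfrak p\in\operatorname{Spec}A$, exist. Moreover, for every choice of them, put $B=\prod_{\mathfrak p\in\operatorname{Spec}A}\rho(s(\mathfrak p))$ and let $J\subseteq B$ be the intersection of the supports of all prime cones $\beta$ of $B$ whose preimage in $A$ belongs to $s(\operatorname{Spec}A)$. Then $A\to B$ is injective; there is an ideal $I\supseteq J$ of $B$ such that $A\to B/I$ is injective and essential; and for every such $I$ the integral closure of $A$ in $B/I$ is a real closure $*$ of $A$ whose class is $\Phi(s)$. -/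

import Mathlib

universe u

/-- A poring: a commutative ring with a partial order compatible with addition and multiplication
in which all squares are nonnegative. The positive cone `A⁺` is `{a | 0 ≤ a}`. -/
class IsPoring (A : Type u) [CommRing A] [PartialOrder A] : Prop extends IsOrderedRing A where
  mul_self_nonneg : ∀ a : A, 0 ≤ a * a

/-- Von Neumann regular commutative rings: every element has a quasi-inverse. -/
def IsVonNeumannRegular (A : Type u) [CommRing A] : Prop :=
  ∀ a : A, ∃ b : A, a * a * b = a

/-- Baer rings: the annihilator of every subset is generated by an idempotent. -/
def IsBaerRing (A : Type u) [CommRing A] : Prop :=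
  ∀ S : Set A, ∃ e : A, IsIdempotentElem e ∧
    {x : A | ∀ s ∈ S, x * s = 0} = (Ideal.span {e} : Set A)

/-- `B` is an essential extension of `A`: the structure map is injective and every nonzero ideal
of `B` meets (the image of) `A` in a nonzero element. -/
def IsEssentialExtension (A B : Type u) [CommRing A] [CommRing B] [Algebra A B] : Prop :=
  Function.Injective (algebraMap A B) ∧
    ∀ I : Ideal B, I ≠ ⊥ → I.comap (algebraMap A B) ≠ ⊥

/-- Real closed `*` rings: (formally) real rings without a proper real extension
that is integral and essential. -/
def IsRealClosedStar (C : Type u) [CommRing C] : Prop :=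
  IsFormallyReal C ∧
    ∀ (D : Type u) [CommRing D] [Algebra C D], IsFormallyReal D → IsEssentialExtension C D →
      Algebra.IsIntegral C D → Function.Surjective (algebraMap C D)

/-- The `A`-algebra `C` is a real closure `*` of the poring `A`: it is a real closed `*` ring,
it is an integral and essential extension of `A`, and it is an extension of porings, i.e. `C` can
be ordered in such a way that `A → C` preserves the order. -/
def IsRealClosureStar (A C : Type u) [CommRing A] [PartialOrder A] [CommRing C] [Algebra A C] :
    Prop :=
  IsRealClosedStar C ∧ Algebra.IsIntegral A C ∧ IsEssentialExtension A C ∧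
    ∃ _ : PartialOrder C, IsPoring C ∧ ∀ a : A, 0 ≤ a → 0 ≤ algebraMap A C a

/-- The real closures `*` of `A` (bundled). -/
structure RealClosureStar (A : Type u) [CommRing A] [PartialOrder A] where
  carrier : Type u
  [commRing : CommRing carrier]
  [algebra : Algebra A carrier]
  isRealClosureStar : IsRealClosureStar A carrier

attribute [instance] RealClosureStar.commRing RealClosureStar.algebra

/-- The relation of `A`-isomorphism on the real closures `*` of `A`. -/
instance RealClosureStar.isoSetoid (A : Type u) [CommRing A] [PartialOrder A] :
    Setoid (RealClosureStar A) where
  r C D := Nonempty (C.carrier ≃ₐ[A] D.carrier)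
  iseqv :=
    { refl := fun _ => ⟨AlgEquiv.refl⟩
      symm := fun ⟨e⟩ => ⟨e.symm⟩
      trans := fun ⟨e⟩ ⟨f⟩ => ⟨e.trans f⟩ }

/-- The set of real closures `*` of `A` up to `A`-isomorphism. -/
abbrev RealClosureStarClasses (A : Type u) [CommRing A] [PartialOrder A] : Type (u + 1) :=
  Quotient (RealClosureStar.isoSetoid A)

/-- The prime cones of a commutative ring: subsemirings `α` with `α ∪ -α = A` whose support
`α ∩ -α` is a prime ideal. -/
def PrimeCone (A : Type u) [CommRing A] : Type u :=
  {P : RingPreordering A // P.IsOrdering}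

namespace PrimeCone

variable {A B : Type u} [CommRing A] [CommRing B]

instance : SetLike (PrimeCone A) A where
  coe α := (α.1 : Set A)
  coe_injective _ _ h := Subtype.ext (SetLike.coe_injective h)

instance (α : PrimeCone A) : α.1.IsOrdering := α.2

/-- The support of a prime cone, as a point of the prime spectrum. -/
def supp (α : PrimeCone A) : PrimeSpectrum A :=
  ⟨α.1.support, inferInstance⟩

/-- The contraction of a prime cone along a ring homomorphism. -/
def comap (f : A →+* B) (β : PrimeCone B) : PrimeCone A :=
  ⟨RingPreordering.mk' {a | f a ∈ β.1}
      (fun {x y} hx hy => by simpa using add_mem (show f x ∈ β.1 from hx) hy)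
      (fun {x y} hx hy => by simpa using mul_mem (show f x ∈ β.1 from hx) hy)
      (fun x => by simp)
      (by simpa using β.1.neg_one_notMem),
    RingPreordering.isOrdering_iff.2 fun a b h =>
      RingPreordering.isOrdering_iff.1 β.2 (f a) (f b)
        (by simpa using (show f (-(a * b)) ∈ β.1 from h))⟩

/-- The Harrison topology, with subbasis the sets `P(x) = {α | x ∈ α \ supp α}`. -/
instance : TopologicalSpace (PrimeCone A) :=
  TopologicalSpace.generateFrom
    {U | ∃ x : A, U = {α : PrimeCone A | x ∈ α ∧ x ∉ α.supp.asIdeal}}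

end PrimeCone

/-- The real spectrum of a poring: the prime cones that contain the positive cone, with the
Harrison topology. -/
abbrev Sper (A : Type u) [CommRing A] [PartialOrder A] : Type u :=
  {α : PrimeCone A // ∀ a : A, 0 ≤ a → a ∈ α}

/-- The continuous sections of the support map `supp : Sper A → Spec A`. -/
abbrev SuppSection (A : Type u) [CommRing A] [PartialOrder A] : Type u :=
  {s : PrimeSpectrum A → Sper A // Continuous s ∧ ∀ p, (s p).1.supp = p}

/-- `R` is (a model of) the real closed field `ρ(α)`: a real closed field that is an algebraic
extension of the fraction field of `A / supp α` and in which the elements of `α` are nonnegative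
(i.e. squares). Algebraicity is expressed by polynomials over `A` that do not vanish
modulo `supp α`. -/
structure IsRho {A : Type u} [CommRing A] (α : PrimeCone A) (R : Type u) [Field R] [Algebra A R] :
    Prop where
  isRealClosed : IsRealClosed R
  ker_eq : RingHom.ker (algebraMap A R) = α.supp.asIdeal
  algebraic : ∀ r : R, ∃ f : Polynomial A,
    f.map (algebraMap A R) ≠ 0 ∧ Polynomial.aeval r f = 0
  isSquare : ∀ a ∈ α, IsSquare (algebraMap A R a)

/-- For an `A`-algebra `B` and a set `X` of prime cones of `A`, the intersection of the supports of
all prime cones of `B` whose contraction to `A` belongs to `X`. -/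
def vanishingIdealOver {A : Type u} [CommRing A] (B : Type u) [CommRing B] [Algebra A B]
    (X : Set (PrimeCone A)) : Ideal B :=
  ⨅ β ∈ PrimeCone.comap (algebraMap A B) ⁻¹' X, (PrimeCone.supp β).asIdeal

/-! Over a von Neumann regular ring, spaces and ideals are governed by idempotents. Over a Baer
ring, every idempotent of an essential extension already lies in the base ring
(`IsBaerRing.exists_algebraMap_eq`). Statements that hold at one prime can therefore be spread over
a clopen set cut out by an idempotent of `A`, and this replaces all gluing.

From sections to closures: a quotient of a product of real closed fields inherits what can be solved
coordinatewise, namely sign decompositions by idempotents and roots of monic polynomials of odd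
degree. If `A` is essential in such a quotient, these solutions descend to the integral closure `D`
of `A`, so the residue fields of `D` are real closed. By
`isRealClosedStar_of_isRealClosed_quotient`, `D` is then real closed `*`. Suitable ideals `I` come
from Zorn's lemma, and `J = 0` because the evaluations of the product already produce enough prime
cones.

From closures to sections: a poring order on a closure `C` extends to a maximal cone `T`. By
Baer-ness `T` is total up to idempotents of `A`, so its localizations are prime cones. Their
contractions to `A` form a section, continuous because membership at a point is witnessed by an
idempotent of `A`. A map from `C` to each `ρ(s(p))` gives an embedding of `C` into any integral
closure built from `s`. That embedding is integral and essential, hence an isomorphism.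

The section is recovered from its closure: `a` lies in `s(p)` exactly when `e * a` is a square in
the closure for some idempotent `e` outside `p` (`SuppSection.mem_iff`). Independence of the chosen
fields rests on existence and uniqueness of real closures of ordered fields, which the opening
sections prove by Artin–Schreier theory. -/

open Polynomial

/-! ### Orderings of fields and the order of a real closed field. -/

section Ordering

variable {F : Type*} [Field F]

theorem exists_linearOrder_of_ringPreordering (P : RingPreordering F)
    (h : ∀ x, x ∈ P ∨ -x ∈ P) :
    ∃ (_ : LinearOrder F) (_ : IsStrictOrderedRing F), ∀ x : F, 0 ≤ x ↔ x ∈ P := by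
  classical
  let C : RingCone F :=
    { P.toSubsemiring with
      eq_zero_of_mem_of_neg_mem' := fun h1 h2 =>
        RingPreordering.eq_zero_of_mem_of_neg_mem (P := P) h1 h2 }
  have : HasMemOrNegMem C := ⟨h⟩
  let _ : LinearOrder F := LinearOrder.mkOfAddGroupCone C
  have : IsOrderedRing F := IsOrderedRing.mkOfCone C
  refine ⟨inferInstance, IsOrderedRing.toIsStrictOrderedRing F, fun x => ?_⟩
  change x - 0 ∈ C ↔ _
  rw [sub_zero]
  rfl

/-- If neither `x` nor `-x` lies in `P`, then `P + xP` is a strictly larger preordering: an equation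
`-1 = a + x * b` would give `-x = (1 + a) / b ∈ P`. -/
theorem RingPreordering.mem_or_neg_mem_of_maximal (P : RingPreordering F)
    (hP : ∀ Q : RingPreordering F, P ≤ Q → Q ≤ P) (x : F) : x ∈ P ∨ -x ∈ P := by
  by_contra! hx
  let Q : RingPreordering F := RingPreordering.mk' {z | ∃ a ∈ P, ∃ b ∈ P, z = a + x * b}
    (by
      rintro _ _ ⟨a, ha, b, hb, rfl⟩ ⟨c, hc, d, hd, rfl⟩
      exact ⟨a + c, add_mem ha hc, b + d, add_mem hb hd, by ring⟩)
    (by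
      rintro _ _ ⟨a, ha, b, hb, rfl⟩ ⟨c, hc, d, hd, rfl⟩
      exact ⟨a * c + x * x * (b * d),
        add_mem (mul_mem ha hc) (mul_mem (P.mul_self_mem x) (mul_mem hb hd)),
        a * d + b * c, add_mem (mul_mem ha hd) (mul_mem hb hc), by ring⟩)
    (fun y => ⟨y * y, P.mul_self_mem y, 0, zero_mem P, by ring⟩)
    (by
      rintro ⟨a, ha, b, hb, h⟩
      have hb0 : b ≠ 0 := by
        rintro rfl
        exact P.neg_one_notMem (by simpa [h] using ha)
      refine hx.2 ?_
      have : -x = (1 + a) * b⁻¹ := by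
        field_simp
        linear_combination h
      rw [this]
      exact mul_mem (add_mem (one_mem P) ha) (RingPreordering.inv_mem hb))
  have hPQ : P ≤ Q := fun a ha => ⟨a, ha, 0, zero_mem P, by ring⟩
  exact hx.1 (hP Q hPQ ⟨0, zero_mem P, 1, one_mem P, by ring⟩)

theorem RingPreordering.exists_le_mem_or_neg_mem (P : RingPreordering F) :
    ∃ Q : RingPreordering F, P ≤ Q ∧ ∀ x, x ∈ Q ∨ -x ∈ Q := by
  obtain ⟨Q, hPQ, hQ⟩ := zorn_le_nonempty_Ici₀ P (fun c _ hc y hy => by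
    refine ⟨RingPreordering.mk' {z | ∃ Q ∈ c, z ∈ Q} ?_ ?_ ?_ ?_, ?_⟩
    · rintro a b ⟨Q, hQ, ha⟩ ⟨Q', hQ', hb⟩
      rcases hc.total hQ hQ' with h | h
      · exact ⟨Q', hQ', add_mem (h ha) hb⟩
      · exact ⟨Q, hQ, add_mem ha (h hb)⟩
    · rintro a b ⟨Q, hQ, ha⟩ ⟨Q', hQ', hb⟩
      rcases hc.total hQ hQ' with h | h
      · exact ⟨Q', hQ', mul_mem (h ha) hb⟩
      · exact ⟨Q, hQ, mul_mem ha (h hb)⟩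
    · exact fun x => ⟨y, hy, y.mul_self_mem x⟩
    · rintro ⟨Q, -, h⟩
      exact Q.neg_one_notMem h
    · exact fun Q hQ a ha => ⟨Q, hQ, ha⟩) P le_rfl
  exact ⟨Q, hPQ, Q.mem_or_neg_mem_of_maximal fun Q' h => hQ h⟩

theorem IsRealClosed.exists_linearOrder [IsRealClosed F] :
    ∃ (_ : LinearOrder F) (_ : IsStrictOrderedRing F), ∀ x : F, 0 ≤ x ↔ IsSquare x := by
  refine exists_linearOrder_of_ringPreordering (RingPreordering.mk' {x : F | IsSquare x} ?_
    (fun h h' => IsSquare.mul h h') (fun x => ⟨x, rfl⟩) ?_)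
    (fun x => IsRealClosed.isSquare_or_isSquare_neg x)
  · rintro _ _ ⟨x, rfl⟩ ⟨y, rfl⟩
    -- If instead `x² + y² = -z²` with `x ≠ 0`, division by `x²` makes `-1` a sum of squares.
    rcases IsRealClosed.isSquare_or_isSquare_neg (x * x + y * y) with h | ⟨z, hz⟩
    · exact h
    · by_cases hx : x = 0
      · exact ⟨y, by simp [hx]⟩
      · exfalso
        have : (1 : F) + (y / x * (y / x) + z / x * (z / x)) = 0 := by
          field_simp
          linear_combination -hz
        exact IsSemireal.one_add_ne_zero ((IsSumSq.mul_self _).add (IsSumSq.mul_self _)) this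
  · exact fun h => IsSemireal.not_isSumSq_neg_one F (IsSquare.isSumSq h)

end Ordering

/-! ### Sign changes of polynomials and weighted sums of squares. -/

section SignChange

variable {F : Type*} [Field F] [LinearOrder F]

/-- The polynomials of the form `∑ tᵢ gᵢ²` with `0 ≤ tᵢ`. -/
noncomputable def weightedSumSqPolynomial (F : Type*) [Field F] [LinearOrder F] :
    AddSubmonoid F[X] :=
  AddSubmonoid.closure {w | ∃ t : F, 0 ≤ t ∧ ∃ g : F[X], w = C t * (g * g)}

/-- Each `g` is replaced by its remainder modulo `f`, with the weights kept. The degree bound drives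
the descent in `not_dvd_one_add_of_sign_change`. -/
theorem exists_reduced_mem_weightedSumSqPolynomial {w f : F[X]}
    (hw : w ∈ weightedSumSqPolynomial F) (hf : 0 < f.natDegree) :
    ∃ v ∈ weightedSumSqPolynomial F, f ∣ w - v ∧ v.natDegree ≤ 2 * (f.natDegree - 1) := by
  induction hw using AddSubmonoid.closure_induction with
  | mem w h =>
    obtain ⟨t, ht, g, rfl⟩ := h
    refine ⟨C t * ((g % f) * (g % f)), AddSubmonoid.subset_closure ⟨t, ht, _, rfl⟩, ?_, ?_⟩
    · have : f ∣ g - g % f := ⟨g / f, by linear_combination -EuclideanDomain.div_add_mod g f⟩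
      obtain ⟨q, hq⟩ := this
      exact ⟨C t * q * (g + g % f), by linear_combination C t * (g + g % f) * hq⟩
    · have h1 : (g % f).natDegree < f.natDegree := natDegree_mod_lt g hf.ne'
      have h2 := natDegree_C_mul_le t ((g % f) * (g % f))
      have h3 := natDegree_mul_le (p := g % f) (q := g % f)
      omega
  | zero => exact ⟨0, zero_mem _, by simp, by simp⟩
  | add x y _ _ hx hy =>
    obtain ⟨v, hv, hd, hn⟩ := hx
    obtain ⟨v', hv', hd', hn'⟩ := hy
    exact ⟨v + v', add_mem hv hv', by simpa [add_sub_add_comm] using dvd_add hd hd',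
      (natDegree_add_le _ _).trans (max_le hn hn')⟩

variable [IsStrictOrderedRing F]

theorem eval_nonneg_of_mem_weightedSumSqPolynomial {w : F[X]}
    (hw : w ∈ weightedSumSqPolynomial F) (a : F) : 0 ≤ w.eval a := by
  induction hw using AddSubmonoid.closure_induction with
  | mem w h =>
    obtain ⟨t, ht, g, rfl⟩ := h
    simpa using mul_nonneg ht (mul_self_nonneg _)
  | zero => simp
  | add x y _ _ hx hy => simpa using add_nonneg hx hy

/-- A polynomial that changes sign does not divide `1 + ∑ tᵢ gᵢ²`, `0 ≤ tᵢ`. -/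
theorem not_dvd_one_add_of_sign_change {f w : F[X]} {a b : F} (hab : f.eval a * f.eval b < 0)
    (hw : w ∈ weightedSumSqPolynomial F) : ¬ f ∣ 1 + w := by
  induction hn : f.natDegree using Nat.strong_induction_on generalizing f w with
  | _ n ih =>
    intro hdvd
    have hf : 0 < f.natDegree := by
      rw [Nat.pos_iff_ne_zero]
      intro h0
      rw [eq_C_of_natDegree_eq_zero h0] at hab
      simp only [eval_C] at hab
      exact absurd hab (not_lt.2 (mul_self_nonneg _))
    obtain ⟨v, hv, hvd, hvn⟩ := exists_reduced_mem_weightedSumSqPolynomial hw hf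
    obtain ⟨h, hh⟩ : f ∣ 1 + v := by
      have := dvd_sub hdvd hvd
      rwa [show 1 + w - (w - v) = 1 + v by ring] at this
    -- Since `f * h = 1 + v` is positive everywhere, the cofactor `h` has the sign of `f` at every
    -- point. It thus also changes sign between `a` and `b`, divides `1 + v`, and has smaller degree
    -- than `f`: infinite descent.
    have hpos : ∀ c, 0 < f.eval c * h.eval c := by
      intro c
      rw [← eval_mul, ← hh]
      simpa using add_pos_of_pos_of_nonneg one_pos
        (eval_nonneg_of_mem_weightedSumSqPolynomial hv c)
    have hf0 : f ≠ 0 := by rintro rfl; simp at hf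
    have hh0 : h ≠ 0 := by rintro rfl; simpa using hpos 0
    have hdeg : h.natDegree < n := by
      have h1 := natDegree_mul hf0 hh0
      rw [← hh] at h1
      have h2 := natDegree_add_le 1 v
      simp only [natDegree_one] at h2
      omega
    refine ih _ hdeg (f := h) ?_ hv rfl ⟨f, by rw [hh, mul_comm]⟩
    have := mul_pos (hpos a) (hpos b)
    by_contra! h3
    have h4 := mul_nonpos_of_nonpos_of_nonneg hab.le h3
    rw [mul_mul_mul_comm] at this
    exact this.not_ge h4

theorem exists_irreducible_dvd_of_sign_change {f : F[X]} {a b : F}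
    (hf : f.eval a * f.eval b < 0) :
    ∃ g, Irreducible g ∧ g ∣ f ∧ g.eval a * g.eval b < 0 := by
  induction hn : f.natDegree using Nat.strong_induction_on generalizing f with
  | _ n ih =>
    have hdeg : f.natDegree ≠ 0 := by
      intro h0
      rw [eq_C_of_natDegree_eq_zero h0] at hf
      simp only [eval_C] at hf
      exact absurd hf (not_lt.2 (mul_self_nonneg _))
    have hf0 : f ≠ 0 := by rintro rfl; simp at hdeg
    by_cases hirr : Irreducible f
    · exact ⟨f, hirr, dvd_rfl, hf⟩
    · obtain ⟨g, h, hg, hh, rfl⟩ : ∃ g h, ¬ IsUnit g ∧ ¬ IsUnit h ∧ f = g * h := by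
        by_contra! hcon
        refine hirr ⟨fun hu => hdeg (natDegree_eq_zero_of_isUnit hu), fun g h hgh => ?_⟩
        by_contra! h'
        exact hcon g h h'.1 h'.2 hgh
      have hg0 := left_ne_zero_of_mul hf0
      have hh0 := right_ne_zero_of_mul hf0
      have hdg : 0 < g.natDegree := Nat.pos_of_ne_zero fun h0 => hg
        (isUnit_iff_degree_eq_zero.2 (by rw [degree_eq_natDegree hg0, h0]; rfl))
      have hdh : 0 < h.natDegree := Nat.pos_of_ne_zero fun h0 => hh
        (isUnit_iff_degree_eq_zero.2 (by rw [degree_eq_natDegree hh0, h0]; rfl))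
      rw [natDegree_mul hg0 hh0] at hn
      by_cases hgs : g.eval a * g.eval b < 0
      · obtain ⟨z, h1, h2, h3⟩ := ih _ (by omega) hgs rfl
        exact ⟨z, h1, h2.mul_right _, h3⟩
      · have hhs : h.eval a * h.eval b < 0 := by
          by_contra! h1
          rw [eval_mul, eval_mul, mul_mul_mul_comm] at hf
          exact hf.not_ge (mul_nonneg (not_lt.1 hgs) h1)
        obtain ⟨z, h1, h2, h3⟩ := ih _ (by omega) hhs rfl
        exact ⟨z, h1, h2.mul_left _, h3⟩

end SignChange

/-! ### Bounds for polynomials with positive leading coefficient. -/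

section Bound

variable {F L : Type*} [Field F] [LinearOrder F] [IsStrictOrderedRing F]
  [Field L] [LinearOrder L] [IsStrictOrderedRing L] [Algebra F L]

/-- Induction by Horner's rule. The bounds lie in `F` while `x` ranges over `L`, so integral
elements of `L` are bounded by elements of `F`; the case `L = F` gives sign changes in odd degree.
-/
theorem exists_forall_le_aeval (hFL : StrictMono (algebraMap F L)) (f : F[X])
    (hf : 0 < f.leadingCoeff) :
    ∃ M δ : F, 0 < δ ∧ ∀ x : L, algebraMap F L M ≤ x → algebraMap F L δ ≤ aeval x f := by
  induction hn : f.natDegree generalizing f with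
  | zero =>
    refine ⟨0, f.leadingCoeff, hf, fun x _ => ?_⟩
    rw [leadingCoeff, hn]
    conv_rhs => rw [eq_C_of_natDegree_eq_zero hn]
    simp
  | succ n ih =>
    have hlc : f.divX.leadingCoeff = f.leadingCoeff := by
      rw [leadingCoeff, leadingCoeff, natDegree_divX_eq_natDegree_tsub_one, coeff_divX, hn]
      simp
    obtain ⟨M, δ, hδ, h⟩ := ih f.divX (hlc ▸ hf) (by
      rw [natDegree_divX_eq_natDegree_tsub_one, hn]; simp)
    -- For such `x`, `f(x) = divX(x) * x + f(0) ≥ δ * x + f(0) ≥ 1`.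
    refine ⟨max M (max 0 ((1 - f.coeff 0) / δ)), 1, one_pos, fun x hx => ?_⟩
    have hM : algebraMap F L M ≤ x := (hFL.monotone (le_max_left _ _)).trans hx
    have h0 : 0 ≤ x := by
      simpa using (hFL.monotone ((le_max_left _ _).trans (le_max_right _ _))).trans hx
    have h1 : algebraMap F L ((1 - f.coeff 0) / δ) ≤ x :=
      (hFL.monotone ((le_max_right _ _).trans (le_max_right _ _))).trans hx
    have hδ' : 0 < algebraMap F L δ := by simpa using hFL hδ
    have h2 := h x hM
    conv_rhs => rw [← divX_mul_X_add f]
    simp only [map_add, map_mul, aeval_X, aeval_C, map_one]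
    rw [map_div₀, div_le_iff₀ hδ', map_sub, map_one] at h1
    nlinarith [mul_le_mul_of_nonneg_right h2 h0]

end Bound

/-! ### Finite extensions of real closed fields and the intermediate value theorem. -/

section RealClosed

variable {R : Type*} [Field R] [IsRealClosed R]

theorem IsRealClosed.finrank_eq_one_of_odd {L : Type*} [Field L] [Algebra R L]
    [FiniteDimensional R L] (h : Odd (Module.finrank R L)) : Module.finrank R L = 1 := by
  obtain ⟨x, hx⟩ := Field.exists_primitive_element R L
  have hintegral : IsIntegral R x := Algebra.IsIntegral.isIntegral x
  have hdeg : (minpoly R x).natDegree = Module.finrank R L := by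
    rw [← IntermediateField.adjoin.finrank hintegral, hx, IntermediateField.finrank_top']
  obtain ⟨r, hr⟩ := IsRealClosed.exists_isRoot_of_odd_natDegree (hdeg ▸ h)
  rw [← hdeg]
  exact natDegree_eq_of_degree_eq_some
    (degree_eq_one_of_irreducible_of_root (minpoly.irreducible hintegral) hr)

theorem IsRealClosed.exists_sq_eq_neg_one_of_finrank_eq_two {L : Type*} [Field L] [Algebra R L]
    (h : Module.finrank R L = 2) : ∃ i : L, i * i = -1 := by
  have : FiniteDimensional R L := FiniteDimensional.of_finrank_pos (by omega)
  obtain ⟨x, hx⟩ := Field.exists_primitive_element R L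
  have hintegral : IsIntegral R x := Algebra.IsIntegral.isIntegral x
  have hdeg : (minpoly R x).natDegree = 2 := by
    rw [← h, ← IntermediateField.adjoin.finrank hintegral, hx, IntermediateField.finrank_top']
  have hxR : ∀ r : R, algebraMap R L r ≠ x := by
    intro r hr
    have : (minpoly R x).natDegree = 1 := by rw [← hr, minpoly.eq_X_sub_C]; simp
    omega
  have hroot := minpoly.aeval R x
  rw [aeval_eq_sum_range, hdeg] at hroot
  simp only [Finset.sum_range_succ, Finset.sum_range_zero, Algebra.smul_def] at hroot
  have hlc : (minpoly R x).coeff 2 = 1 := by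
    rw [← hdeg]; exact minpoly.monic hintegral
  rw [hlc] at hroot
  set b := (minpoly R x).coeff 1
  set c := (minpoly R x).coeff 0
  set y := 2 * x + algebraMap R L b with hy
  have h2 : (2 : L) ≠ 0 := by
    rw [← map_ofNat (algebraMap R L) 2]
    exact (_root_.map_ne_zero _).2 two_ne_zero
  -- Completing the square: `y² = b² - 4c`. This discriminant is not a square in `R`, so its
  -- negative is a square `s²`, and `y / s` is a square root of `-1`.
  have hyy : y * y = algebraMap R L (b * b - 4 * c) := by
    simp only [map_sub, map_mul, map_ofNat, hy]
    simp only [map_one] at hroot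
    linear_combination 4 * hroot
  have hyR : ∀ r : R, algebraMap R L r ≠ y := by
    intro r hr
    refine hxR ((r - b) / 2) ?_
    rw [map_div₀, map_sub, map_ofNat, hr, hy]
    field_simp
    ring
  rcases IsRealClosed.isSquare_or_isSquare_neg (b * b - 4 * c) with ⟨s, hs⟩ | ⟨s, hs⟩
  · exfalso
    rw [hs, map_mul, mul_self_eq_mul_self_iff] at hyy
    rcases hyy with h' | h'
    · exact hyR s h'.symm
    · exact hyR (-s) (by rw [map_neg, h'])
  · have hs0 : algebraMap R L s ≠ 0 := by
      intro h0
      rw [map_eq_zero] at h0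
      have : b * b - 4 * c = 0 := by simpa [h0] using congrArg Neg.neg hs
      rw [this, map_zero, mul_self_eq_zero] at hyy
      exact hyR 0 (by simp [hyy])
    refine ⟨y / algebraMap R L s, ?_⟩
    rw [div_mul_div_comm, hyy, ← map_mul, ← hs, map_neg, div_neg, div_self]
    intro h0
    apply hs0
    rw [← mul_self_eq_zero, ← map_mul, ← hs, map_neg, h0, neg_zero]

/-- A real closed field has no proper finite extension without a square root of `-1`. -/
theorem IsRealClosed.finrank_eq_one {L : Type*} [Field L] [Algebra R L]
    [FiniteDimensional R L] (h : ∀ i : L, i * i ≠ -1) : Module.finrank R L = 1 := by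
  let E := IntermediateField.normalClosure R L (AlgebraicClosure L)
  have : Fact (Nat.Prime 2) := ⟨Nat.prime_two⟩
  have : IsGalois R E := {}
  have hindex (H : Subgroup Gal(E/R)) :
      Module.finrank R (IntermediateField.fixedField H) = H.index := by
    rw [IntermediateField.finrank_eq_fixingSubgroup_index,
      IntermediateField.fixingSubgroup_fixedField]
  have hcard : ∃ k, Nat.card Gal(E/R) = 2 ^ k := by
    obtain ⟨P⟩ : Nonempty (Sylow 2 Gal(E/R)) := inferInstance
    -- The fixed field of a Sylow 2-subgroup has odd degree over `R`, hence degree one; the Galois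
    -- group is a 2-group.
    have hodd : Odd (P : Subgroup Gal(E/R)).index :=
      Nat.not_even_iff_odd.1 fun h => P.not_dvd_index (even_iff_two_dvd.1 h)
    rw [← hindex] at hodd
    have h1 := IsRealClosed.finrank_eq_one_of_odd hodd
    rw [hindex] at h1
    obtain ⟨k, hk⟩ := IsPGroup.iff_card.1 P.isPGroup'
    exact ⟨k, by rw [← (P : Subgroup Gal(E/R)).card_mul_index, h1, mul_one, hk]⟩
  obtain ⟨k, hk⟩ := hcard
  let φ : L →ₐ[R] E := IsScalarTower.toAlgHom R L E
  let e : L ≃ₐ[R] φ.fieldRange := AlgEquiv.ofInjectiveField φ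
  set H := φ.fieldRange.fixingSubgroup with hH
  obtain ⟨n, -, hn⟩ : ∃ n ≤ k, Nat.card H = 2 ^ n :=
    (Nat.dvd_prime_pow Nat.prime_two).1 (hk ▸ H.card_subgroup_dvd_card)
  have hnk := H.card_mul_index
  rw [hn, hk] at hnk
  rw [e.toLinearEquiv.finrank_eq, IntermediateField.finrank_eq_fixingSubgroup_index]
  by_contra hne
  have hlt : n < k := by
    by_contra! hle
    apply hne
    have h1 : 2 ^ k ≤ 2 ^ n := Nat.pow_le_pow_right two_pos hle
    have h2 : 0 < 2 ^ k := by positivity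
    rw [← hH]
    nlinarith [Nat.pos_of_ne_zero H.index_ne_zero_of_finite]
  -- In a 2-group a proper subgroup lies in one of index 2. The fixed field of `K` is a quadratic
  -- extension of `R` inside the image of `L`, so it brings a square root of `-1` into `L`.
  obtain ⟨K, hK, hHK⟩ := Sylow.exists_subgroup_card_pow_prime_le 2
    (show 2 ^ (k - 1) ∣ Nat.card Gal(E/R) from hk ▸ pow_dvd_pow 2 (by omega)) H hn (by omega)
  have hK2 : Module.finrank R (IntermediateField.fixedField K) = 2 := by
    have h1 := K.card_mul_index
    rw [hK, hk, ← Nat.sub_add_cancel (show 1 ≤ k by omega), pow_succ] at h1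
    rw [hindex]
    exact Nat.eq_of_mul_eq_mul_left (by positivity) h1
  obtain ⟨i, hi⟩ := IsRealClosed.exists_sq_eq_neg_one_of_finrank_eq_two hK2
  have hle : IntermediateField.fixedField K ≤ φ.fieldRange := by
    rw [← IsGalois.fixedField_fixingSubgroup φ.fieldRange]
    exact IntermediateField.fixedField_antitone hHK
  obtain ⟨j, hj⟩ := hle i.2
  refine h j ((φ : L →+* E).injective ?_)
  change φ j = i at hj
  change φ (j * j) = φ (-1)
  rw [map_mul, map_neg, map_one, hj]
  exact congrArg Subtype.val hi

variable [LinearOrder R] [IsStrictOrderedRing R]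

/-- The intermediate value theorem for polynomials over a real closed field. -/
theorem IsRealClosed.exists_root_of_sign_change {f : R[X]} {a b : R} (hab : a < b)
    (hf : f.eval a * f.eval b < 0) : ∃ z, a < z ∧ z < b ∧ f.eval z = 0 := by
  obtain ⟨g, hirr, hgf, hg⟩ := exists_irreducible_dvd_of_sign_change hf
  have hg0 := hirr.ne_zero
  have : Fact (Irreducible g) := ⟨hirr⟩
  have : FiniteDimensional R (AdjoinRoot g) := (AdjoinRoot.powerBasis hg0).finite
  have h1 : Module.finrank R (AdjoinRoot g) = 1 := by
    -- A square root of `-1` in `R[X]/(g)`, represented by `q`, would give `g ∣ 1 + q²` although `g`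
    -- changes sign.
    refine IsRealClosed.finrank_eq_one fun i hi => ?_
    obtain ⟨q, rfl⟩ := AdjoinRoot.mk_surjective i
    refine not_dvd_one_add_of_sign_change hg (w := C 1 * (q * q))
      (AddSubmonoid.subset_closure ⟨1, zero_le_one, q, rfl⟩) ?_
    rw [← AdjoinRoot.mk_eq_zero]
    simp [hi]
  rw [(AdjoinRoot.powerBasis hg0).finrank, AdjoinRoot.powerBasis_dim] at h1
  obtain ⟨z, hz⟩ := exists_root_of_degree_eq_one (degree_eq_iff_natDegree_eq hg0 |>.2 h1)
  obtain ⟨q, hq⟩ := dvd_iff_isRoot.2 hz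
  have hq0 : q.natDegree = 0 := by
    have := natDegree_mul (X_sub_C_ne_zero z) (q := q) (by rintro rfl; simp [hq] at hg0)
    rw [← hq, h1, natDegree_X_sub_C] at this
    omega
  rw [eq_C_of_natDegree_eq_zero hq0] at hq
  have h3 : (a - z) * (b - z) < 0 := by
    simp only [hq, eval_mul, eval_sub, eval_X, eval_C] at hg
    by_contra! h4
    nlinarith [mul_nonneg h4 (mul_self_nonneg (q.coeff 0))]
  refine ⟨z, ?_, ?_, eval_eq_zero_of_dvd_of_eval_eq_zero hgf hz⟩ <;> nlinarith

end RealClosed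

/-! ### Rolle's theorem and isolation of simple roots. -/

section Rolle

variable {R : Type*} [Field R] [IsRealClosed R] [LinearOrder R] [IsStrictOrderedRing R]

/-- The theorem of Rolle for polynomials with simple roots over a real closed field. -/
theorem IsRealClosed.exists_derivative_eq_zero {f : R[X]}
    (hf : ∀ z, f.eval z = 0 → (derivative f).eval z ≠ 0) {x y : R} (hxy : x < y)
    (hx : f.eval x = 0) (hy : f.eval y = 0) :
    ∃ z, x < z ∧ z < y ∧ (derivative f).eval z = 0 := by
  have hf0 : f ≠ 0 := by
    rintro rfl
    exact hf x hx (by simp)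
  have hne : (f.roots.toFinset.filter (x < ·)).Nonempty :=
    ⟨y, by simp [hf0, hy, hxy]⟩
  -- Let `w` be the first root after `x` and `f = (X - x)(X - w)r`. Then `r` has the same sign at
  -- `x` and `w`, so `f'(x) = (x - w)r(x)` and `f'(w) = (w - x)r(w)` have opposite signs.
  obtain ⟨w, hw, hmin⟩ := Finset.exists_min_image _ id hne
  simp only [Finset.mem_filter, Multiset.mem_toFinset, mem_roots hf0, IsRoot.def, id] at hw hmin
  have hwy : w ≤ y := hmin y ⟨hy, hxy⟩
  obtain ⟨q, hq⟩ := dvd_iff_isRoot.2 hx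
  have hqw : q.eval w = 0 := by
    have := hw.1
    rw [hq, eval_mul, mul_eq_zero] at this
    refine this.resolve_left ?_
    simpa using (sub_pos.2 hw.2).ne'
  obtain ⟨r, hr⟩ := dvd_iff_isRoot.2 hqw
  rw [hr] at hq
  have hdx : (derivative f).eval x = (x - w) * r.eval x := by
    rw [hq]
    simp [derivative_mul]
  have hdw : (derivative f).eval w = (w - x) * r.eval w := by
    rw [hq]
    simp [derivative_mul]
  have hrx : r.eval x ≠ 0 := fun h => hf x hx (by rw [hdx, h, mul_zero])
  have hrw : r.eval w ≠ 0 := fun h => hf w hw.1 (by rw [hdw, h, mul_zero])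
  have hpos : 0 < r.eval x * r.eval w := by
    refine lt_of_le_of_ne (not_lt.1 fun h => ?_) (mul_ne_zero hrx hrw).symm
    obtain ⟨z, h1, h2, h3⟩ := IsRealClosed.exists_root_of_sign_change hw.2 h
    exact (hmin z ⟨by rw [hq]; simp [h3], h1⟩).not_gt h2
  obtain ⟨z, h1, h2, h3⟩ :=
    IsRealClosed.exists_root_of_sign_change (f := derivative f) hw.2 (by
      rw [hdx, hdw]
      have := mul_pos (mul_pos (sub_pos.2 hw.2) (sub_pos.2 hw.2)) hpos
      nlinarith)
  exact ⟨z, h1, h2.trans_le hwy, h3⟩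

/-- Around a simple root `β`, a polynomial changes its sign at `β` and nowhere else, as long as
the derivative does not vanish. -/
theorem IsRealClosed.sign_iff_lt_root {f : R[X]}
    (hf : ∀ z, f.eval z = 0 → (derivative f).eval z ≠ 0) {c β d : R} (hc : c < β) (hd : β < d)
    (hβ : f.eval β = 0) (hder : ∀ z, c < z → z < d → (derivative f).eval z ≠ 0) :
    f.eval c * f.eval d < 0 ∧ ∀ x, c ≤ x → x ≤ d → (0 < f.eval x * f.eval c ↔ x < β) := by
  obtain ⟨q, hq⟩ := dvd_iff_isRoot.2 hβ
  -- A zero of the cofactor `q` would be a second or a double root of `f`, excluded by Rolle or by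
  -- simplicity. So `q` has constant sign on `[c, d]` and the sign of `f` is that of `X - β` up to a
  -- constant.
  have hq0 : ∀ x, c ≤ x → x ≤ d → q.eval x ≠ 0 := by
    intro x hcx hxd hx
    have hfx : f.eval x = 0 := by rw [hq]; simp [hx]
    rcases lt_trichotomy x β with h | rfl | h
    · obtain ⟨z, h1, h2, h3⟩ := IsRealClosed.exists_derivative_eq_zero hf h hfx hβ
      exact hder z (hcx.trans_lt h1) (h2.trans hd) h3
    · refine hf x hfx ?_
      rw [hq]
      simp [derivative_mul, hx]
    · obtain ⟨z, h1, h2, h3⟩ := IsRealClosed.exists_derivative_eq_zero hf h hβ hfx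
      exact hder z (hc.trans h1) (h2.trans_le hxd) h3
  have hpos : ∀ x, c ≤ x → x ≤ d → 0 < q.eval c * q.eval x := by
    intro x hcx hxd
    rcases hcx.eq_or_lt with rfl | hlt
    · exact mul_self_pos.2 (hq0 _ le_rfl hxd)
    · refine lt_of_le_of_ne (not_lt.1 fun h => ?_)
        (mul_ne_zero (hq0 c le_rfl (hc.trans hd).le) (hq0 x hcx hxd)).symm
      obtain ⟨z, h1, h2, h3⟩ := IsRealClosed.exists_root_of_sign_change hlt h
      exact hq0 z h1.le (h2.le.trans hxd) h3
  have hfe : ∀ x, f.eval x = (x - β) * q.eval x := by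
    intro x
    rw [hq]
    simp
  have key : ∀ x, f.eval c * f.eval x = (β - c) * (q.eval c * q.eval x) * (β - x) := by
    intro x
    rw [hfe, hfe]
    ring
  refine ⟨?_, fun x hcx hxd => ?_⟩
  · rw [key]
    exact mul_neg_of_pos_of_neg (mul_pos (sub_pos.2 hc) (hpos d (hc.trans hd).le le_rfl))
      (sub_neg.2 hd)
  · rw [mul_comm, key, mul_pos_iff_of_pos_left (mul_pos (sub_pos.2 hc) (hpos x hcx hxd)), sub_pos]

/-- A polynomial without roots in a real closed field has constant sign. -/
theorem IsRealClosed.eval_pos_iff_of_no_root {f : R[X]} (hf : ∀ z, f.eval z ≠ 0) (x y : R) :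
    0 < f.eval x ↔ 0 < f.eval y := by
  have key : ∀ {a b : R}, a < b → ¬ (f.eval a * f.eval b < 0) := by
    intro a b hab h
    obtain ⟨z, -, -, h3⟩ := IsRealClosed.exists_root_of_sign_change hab h
    exact hf z h3
  have hpos : 0 < f.eval x * f.eval y := by
    refine lt_of_le_of_ne (not_lt.1 fun h => ?_) (mul_ne_zero (hf x) (hf y)).symm
    rcases lt_trichotomy x y with hxy | rfl | hxy
    · exact key hxy h
    · exact h.not_ge (mul_self_nonneg _)
    · exact key hxy (by rwa [mul_comm])
  exact (pos_iff_pos_of_mul_pos hpos)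

end Rolle

/-! ### Transfer of an algebraic element from one real closed field to another. -/

section Transfer

theorem exists_algebraMap_eq_of_aeval_eq_zero {F L : Type*} [Field F] [Field L] [Algebra F L]
    {m : ℕ}
    (hmin : ∀ x : L, IsIntegral F x → (minpoly F x).natDegree < m →
      x ∈ Set.range (algebraMap F L)) {g : F[X]} (hg : g ≠ 0) (hgm : g.natDegree < m) {x : L}
    (hx : aeval x g = 0) : ∃ γ : F, algebraMap F L γ = x ∧ g.eval γ = 0 := by
  obtain ⟨γ, rfl⟩ := hmin x (IsAlgebraic.isIntegral ⟨g, hg, hx⟩)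
    ((natDegree_le_natDegree (minpoly.degree_le_of_ne_zero F x hg hx)).trans_lt hgm)
  refine ⟨γ, rfl, ?_⟩
  rw [aeval_algebraMap_apply] at hx
  simpa using hx

variable {F L R : Type*} [Field F] [LinearOrder F] [IsStrictOrderedRing F]
  [Field L] [LinearOrder L] [IsStrictOrderedRing L]
  [Field R] [LinearOrder R] [IsStrictOrderedRing R] [Algebra F L] [Algebra F R]

theorem exists_bounds_of_isIntegral (hL : StrictMono (algebraMap F L)) {β : L}
    (hβ : IsIntegral F β) : ∃ c d : F, algebraMap F L c < β ∧ β < algebraMap F L d := by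
  have key : ∀ {x : L}, IsIntegral F x → ∃ d : F, x < algebraMap F L d := by
    intro x hx
    obtain ⟨M, δ, hδ, h⟩ := exists_forall_le_aeval hL (minpoly F x)
      (by rw [(minpoly.monic hx).leadingCoeff]; exact one_pos)
    refine ⟨M, not_le.1 fun hle => ?_⟩
    have h1 := h x hle
    rw [minpoly.aeval] at h1
    exact h1.not_gt (by simpa using hL hδ)
  obtain ⟨d, hd⟩ := key hβ
  obtain ⟨c, hc⟩ := key hβ.neg
  exact ⟨-c, d, by rw [map_neg]; exact neg_lt.1 hc, hd⟩

variable [IsRealClosed L] [IsRealClosed R]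

/-- A root of `g` in `F` splits off a linear factor, whose sign is read off the cut. Without one,
`g` has no root in `L` or `R` either, since such a root would have degree below `m`; so `g` has
constant sign and can be compared at `0`. -/
theorem aeval_pos_iff_of_same_cut (hL : StrictMono (algebraMap F L))
    (hR : StrictMono (algebraMap F R)) {m : ℕ}
    (hminL : ∀ x : L, IsIntegral F x → (minpoly F x).natDegree < m →
      x ∈ Set.range (algebraMap F L))
    (hminR : ∀ x : R, IsIntegral F x → (minpoly F x).natDegree < m →
      x ∈ Set.range (algebraMap F R)) {β : L} {β' : R}
    (hcut : ∀ γ : F, (β < algebraMap F L γ ↔ β' < algebraMap F R γ) ∧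
      (algebraMap F L γ < β ↔ algebraMap F R γ < β')) (g : F[X]) (hgm : g.natDegree < m) :
    (0 < aeval β g ↔ 0 < aeval β' g) ∧ (aeval β g < 0 ↔ aeval β' g < 0) := by
  induction hn : g.natDegree generalizing g with
  | zero =>
    rw [eq_C_of_natDegree_eq_zero hn]
    simp only [aeval_C]
    rw [← map_zero (algebraMap F L), ← map_zero (algebraMap F R), hL.lt_iff_lt, hR.lt_iff_lt,
      hL.lt_iff_lt, hR.lt_iff_lt]
    simp
  | succ n ih =>
    have hg0 : g ≠ 0 := by rintro rfl; simp at hn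
    by_cases hroot : ∃ γ, g.eval γ = 0
    · obtain ⟨γ, hγ⟩ := hroot
      obtain ⟨q, rfl⟩ := dvd_iff_isRoot.2 hγ
      have hq : q.natDegree = n := by
        rw [natDegree_mul (X_sub_C_ne_zero γ) (right_ne_zero_of_mul hg0),
          natDegree_X_sub_C] at hn
        omega
      have h1 := ih q (by omega) hq
      have h2 := hcut γ
      simp only [map_mul, map_sub, aeval_X, aeval_C, mul_pos_iff, mul_neg_iff, sub_pos, sub_neg,
        h1.1, h1.2, h2.1, h2.2, and_self]
    · push Not at hroot
      have hgL : ∀ z, (g.map (algebraMap F L)).eval z ≠ 0 := by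
        intro z hz
        rw [eval_map_algebraMap] at hz
        obtain ⟨γ, -, h⟩ := exists_algebraMap_eq_of_aeval_eq_zero hminL hg0 hgm hz
        exact hroot γ h
      have hgR : ∀ z, (g.map (algebraMap F R)).eval z ≠ 0 := by
        intro z hz
        rw [eval_map_algebraMap] at hz
        obtain ⟨γ, -, h⟩ := exists_algebraMap_eq_of_aeval_eq_zero hminR hg0 hgm hz
        exact hroot γ h
      have h1 := IsRealClosed.eval_pos_iff_of_no_root hgL β (algebraMap F L 0)
      have h2 := IsRealClosed.eval_pos_iff_of_no_root hgR β' (algebraMap F R 0)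
      have h3 := hgL β
      have h4 := hgR β'
      simp only [eval_map_algebraMap] at h1 h2 h3 h4
      rw [aeval_algebraMap_apply, ← map_zero (algebraMap F L), hL.lt_iff_lt] at h1
      rw [aeval_algebraMap_apply, ← map_zero (algebraMap F R), hR.lt_iff_lt] at h2
      simp only [map_zero] at h1 h2
      have h5 : 0 < aeval β g ↔ 0 < aeval β' g := h1.trans h2.symm
      refine ⟨h5, ?_⟩
      rw [← not_iff_not, not_lt, not_lt, h3.symm.le_iff_lt, h4.symm.le_iff_lt, h5]

/-- An element `β` of least degree outside `F` has a conjugate in any other real closed field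
in which the elements of smaller degree lie in `F` as well. -/
theorem exists_root_aeval_nonneg_iff (hL : StrictMono (algebraMap F L))
    (hR : StrictMono (algebraMap F R)) {β : L} (hβ : IsIntegral F β)
    (hβF : β ∉ Set.range (algebraMap F L))
    (hminL : ∀ x : L, IsIntegral F x → (minpoly F x).natDegree < (minpoly F β).natDegree →
      x ∈ Set.range (algebraMap F L))
    (hminR : ∀ x : R, IsIntegral F x → (minpoly F x).natDegree < (minpoly F β).natDegree →
      x ∈ Set.range (algebraMap F R)) :
    ∃ β' : R, ∀ g : F[X], 0 ≤ aeval β g ↔ 0 ≤ aeval β' g := by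
  set f := minpoly F β with hf
  have hirr : Irreducible f := minpoly.irreducible hβ
  have hf0 : f ≠ 0 := hirr.ne_zero
  have hdeg0 : 0 < f.natDegree := minpoly.natDegree_pos hβ
  have hd0 : derivative f ≠ 0 := by
    intro h
    exact hdeg0.ne' (derivative_eq_zero.1 h)
  have hdm : (derivative f).natDegree < f.natDegree := natDegree_derivative_lt hdeg0.ne'
  have hsepL : ∀ z, (f.map (algebraMap F L)).eval z = 0 →
      (derivative (f.map (algebraMap F L))).eval z ≠ 0 := by
    intro z hz
    rw [derivative_map, eval_map_algebraMap]
    rw [eval_map_algebraMap] at hz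
    exact hirr.separable.aeval_derivative_ne_zero hz
  have hsepR : ∀ z, (f.map (algebraMap F R)).eval z = 0 →
      (derivative (f.map (algebraMap F R))).eval z ≠ 0 := by
    intro z hz
    rw [derivative_map, eval_map_algebraMap]
    rw [eval_map_algebraMap] at hz
    exact hirr.separable.aeval_derivative_ne_zero hz
  have hne : ∀ γ : F, algebraMap F L γ ≠ β := fun γ h => hβF ⟨γ, h⟩
  obtain ⟨c₀, d₀, hc₀, hd₀⟩ := exists_bounds_of_isIntegral hL hβ
  -- The interval from `c` to `d` isolates `β` between points of `F` with no critical point of `f`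
  -- in between. Critical points have smaller degree than `β`, so all of them in `L` or `R` come
  -- from `F`, and finitely many comparisons suffice.
  obtain ⟨c, hc, hcmax⟩ : ∃ c : F, algebraMap F L c < β ∧
      ∀ γ, (derivative f).eval γ = 0 → algebraMap F L γ < β → γ ≤ c := by
    obtain ⟨c, hc, hmax⟩ := Finset.exists_max_image
      ((insert c₀ (derivative f).roots.toFinset).filter (algebraMap F L · < β)) id
      ⟨c₀, by simp [hc₀]⟩
    refine ⟨c, (Finset.mem_filter.1 hc).2, fun γ h1 h2 => hmax γ ?_⟩
    simp [h1, h2, hd0]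
  obtain ⟨d, hd, hdmin⟩ : ∃ d : F, β < algebraMap F L d ∧
      ∀ γ, (derivative f).eval γ = 0 → β < algebraMap F L γ → d ≤ γ := by
    obtain ⟨d, hd, hmin⟩ := Finset.exists_min_image
      ((insert d₀ (derivative f).roots.toFinset).filter (β < algebraMap F L ·)) id
      ⟨d₀, by simp [hd₀]⟩
    refine ⟨d, (Finset.mem_filter.1 hd).2, fun γ h1 h2 => hmin γ ?_⟩
    simp [h1, h2, hd0]
  have hcd : c < d := hL.lt_iff_lt.1 (hc.trans hd)
  have hzero : ∀ γ, (derivative f).eval γ = 0 → γ ≤ c ∨ d ≤ γ := by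
    intro γ h
    rcases lt_or_gt_of_ne (hne γ) with h' | h'
    · exact .inl (hcmax γ h h')
    · exact .inr (hdmin γ h h')
  have hderL : ∀ z, algebraMap F L c < z → z < algebraMap F L d →
      (derivative (f.map (algebraMap F L))).eval z ≠ 0 := by
    intro z h1 h2 h3
    rw [derivative_map, eval_map_algebraMap] at h3
    obtain ⟨γ, rfl, hγ⟩ := exists_algebraMap_eq_of_aeval_eq_zero hminL hd0 hdm h3
    rw [hL.lt_iff_lt] at h1 h2
    rcases hzero γ hγ with h | h
    · exact h.not_gt h1
    · exact h.not_gt h2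
  have hderR : ∀ z, algebraMap F R c < z → z < algebraMap F R d →
      (derivative (f.map (algebraMap F R))).eval z ≠ 0 := by
    intro z h1 h2 h3
    rw [derivative_map, eval_map_algebraMap] at h3
    obtain ⟨γ, rfl, hγ⟩ := exists_algebraMap_eq_of_aeval_eq_zero hminR hd0 hdm h3
    rw [hR.lt_iff_lt] at h1 h2
    rcases hzero γ hγ with h | h
    · exact h.not_gt h1
    · exact h.not_gt h2
  obtain ⟨hsign, hcutL⟩ := IsRealClosed.sign_iff_lt_root hsepL hc hd
    (by rw [eval_map_algebraMap]; exact minpoly.aeval F β) hderL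
  simp only [eval_map_algebraMap, aeval_algebraMap_apply] at hsign
  rw [← map_mul, ← map_zero (algebraMap F L), hL.lt_iff_lt] at hsign
  obtain ⟨β', h1, h2, h3⟩ := IsRealClosed.exists_root_of_sign_change
    (f := f.map (algebraMap F R)) (hR hcd) (by
      simp only [eval_map_algebraMap, aeval_algebraMap_apply]
      rw [← map_mul, ← map_zero (algebraMap F R), hR.lt_iff_lt]
      exact hsign)
  obtain ⟨-, hcutR⟩ := IsRealClosed.sign_iff_lt_root hsepR h1 h2 h3 hderR
  have hβ' : aeval β' f = 0 := by rwa [eval_map_algebraMap] at h3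
  have hne' : ∀ γ : F, algebraMap F R γ ≠ β' := by
    intro γ h
    rw [← h, aeval_algebraMap_apply, map_eq_zero] at hβ'
    apply hne γ
    have h5 : f.degree = 1 :=
      degree_eq_one_of_irreducible_of_root hirr (x := γ) (by simpa using hβ')
    exact absurd (minpoly.degree_eq_one_iff.1 h5) hβF
  -- Between `c` and `d`, the side of `β` on which `γ` lies is decided by the sign of `f(γ) * f(c)`,
  -- an element of `F`; the same test applies to `β'`.
  have hlt : ∀ γ : F, algebraMap F L γ < β ↔ algebraMap F R γ < β' := by
    intro γ
    rcases le_or_gt γ c with h | h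
    · exact iff_of_true ((hL.monotone h).trans_lt hc) ((hR.monotone h).trans_lt h1)
    rcases le_or_gt d γ with h' | h'
    · exact iff_of_false (hd.trans_le (hL.monotone h')).not_gt
        (h2.trans_le (hR.monotone h')).not_gt
    rw [← hcutL _ (hL h).le (hL h').le, ← hcutR _ (hR h).le (hR h').le]
    simp only [eval_map_algebraMap, aeval_algebraMap_apply]
    rw [← map_mul, ← map_zero (algebraMap F L), hL.lt_iff_lt, ← map_mul,
      ← map_zero (algebraMap F R), hR.lt_iff_lt]
  have hcut : ∀ γ : F, (β < algebraMap F L γ ↔ β' < algebraMap F R γ) ∧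
      (algebraMap F L γ < β ↔ algebraMap F R γ < β') := by
    refine fun γ => ⟨?_, hlt γ⟩
    rw [← not_iff_not, not_lt, not_lt, (hne γ).le_iff_lt, (hne' γ).le_iff_lt]
    exact hlt γ
  refine ⟨β', fun g => ?_⟩
  have hmod := EuclideanDomain.div_add_mod g f
  have hgL : aeval β g = aeval β (g % f) := by
    conv_lhs => rw [← hmod]
    simp [hf]
  have hgR : aeval β' g = aeval β' (g % f) := by
    conv_lhs => rw [← hmod]
    simp [hβ']
  have := aeval_pos_iff_of_same_cut hL hR hminL hminR hcut (g % f)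
    (natDegree_mod_lt g hdeg0.ne')
  rw [hgL, hgR, ← not_lt, ← not_lt, this.2]

end Transfer

/-! ### Uniqueness of the real closure of an ordered field. -/

section Uniqueness

variable {K L R : Type*} [Field K] [Field L] [Field R] [Algebra K L] [Algebra K R]

/-- The `K`-subalgebras of `L × R` along which being a square is preserved: the graphs of the
isomorphisms, as ordered fields, between a subextension of `L / K` and one of `R / K`. -/
def IsSquareGraph (G : Subalgebra K (L × R)) : Prop :=
  ∀ z ∈ G, IsSquare z.1 ↔ IsSquare z.2

theorem IsSquareGraph.exists_maximal
    (h : ∀ k : K, IsSquare (algebraMap K L k) ↔ IsSquare (algebraMap K R k)) :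
    ∃ G : Subalgebra K (L × R), Maximal IsSquareGraph G := by
  obtain ⟨G, -, hG⟩ := zorn_le_nonempty₀ {G : Subalgebra K (L × R) | IsSquareGraph G}
    (fun c hc hchain G₀ hG₀ => by
      refine ⟨sSup c, fun z hz => ?_, fun G hG => le_sSup hG⟩
      have : Nonempty c := ⟨⟨G₀, hG₀⟩⟩
      have hdir : Directed (· ≤ ·) (fun G : c => (G : Subalgebra K (L × R))) :=
        hchain.directedOn.directed_val
      rw [sSup_eq_iSup', ← SetLike.mem_coe, Subalgebra.coe_iSup_of_directed hdir,
        Set.mem_iUnion] at hz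
      obtain ⟨G, hG⟩ := hz
      exact hc G.2 z hG) ⊥ (by
      intro z hz
      obtain ⟨k, rfl⟩ := Algebra.mem_bot.1 hz
      exact h k)
  exact ⟨G, hG⟩

theorem IsRealClosed.eq_zero_iff_isSquare_and_isSquare_neg [IsRealClosed L] (x : L) :
    x = 0 ↔ IsSquare x ∧ IsSquare (-x) := by
  refine ⟨fun h => by simp [h], fun ⟨h1, h2⟩ => ?_⟩
  obtain ⟨_, _, h⟩ := IsRealClosed.exists_linearOrder (F := L)
  rw [← h] at h1 h2
  exact le_antisymm (neg_nonneg.1 h2) h1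

/-- Zero is characterized by squares, so both projections of a square graph are injective. -/
theorem IsSquareGraph.eq_zero_iff [IsRealClosed L] [IsRealClosed R] {G : Subalgebra K (L × R)}
    (hG : IsSquareGraph G) {z : L × R} (hz : z ∈ G) : z.1 = 0 ↔ z.2 = 0 := by
  rw [IsRealClosed.eq_zero_iff_isSquare_and_isSquare_neg z.1, hG z hz,
    IsRealClosed.eq_zero_iff_isSquare_and_isSquare_neg z.2]
  have := hG (-z) (neg_mem hz)
  simp only [Prod.fst_neg, Prod.snd_neg] at this
  rw [this]

/-- A partial isomorphism between real closed algebraic extensions of `K` that is not an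
isomorphism can be extended. -/
theorem IsRealClosed.exists_isSquare_aeval_iff [IsRealClosed L] [IsRealClosed R]
    [Algebra.IsIntegral K L] [Algebra.IsIntegral K R]
    (h : ∀ k : K, IsSquare (algebraMap K L k) ↔ IsSquare (algebraMap K R k))
    (hns : ¬ (Function.Surjective (algebraMap K L) ∧ Function.Surjective (algebraMap K R))) :
    ∃ (β : L) (β' : R), (β ∉ Set.range (algebraMap K L) ∨ β' ∉ Set.range (algebraMap K R)) ∧
      ∀ g : K[X], IsSquare (aeval β g) ↔ IsSquare (aeval β' g) := by
  classical
  obtain ⟨_, _, hL⟩ := IsRealClosed.exists_linearOrder (F := L)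
  obtain ⟨_, _, hR⟩ := IsRealClosed.exists_linearOrder (F := R)
  have hinj : Function.Injective (algebraMap K L) := (algebraMap K L).injective
  let _ : LinearOrder K := LinearOrder.lift' (algebraMap K L) hinj
  have : IsStrictOrderedRing K := Function.Injective.isStrictOrderedRing (algebraMap K L)
    (map_zero _) (map_one _) (map_add _) (map_mul _) Iff.rfl Iff.rfl
  have hmonoL : StrictMono (algebraMap K L) := fun x y hxy => hxy
  have hmonoR : StrictMono (algebraMap K R) := by
    refine Monotone.strictMono_of_injective (fun x y hxy => ?_) (algebraMap K R).injective
    have hxy' : algebraMap K L x ≤ algebraMap K L y := hxy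
    rw [← sub_nonneg, ← map_sub, hL, h] at hxy'
    rwa [← sub_nonneg, ← map_sub, hR]
  -- The least degree is taken over both fields at once, so that below it neither field contains
  -- anything new; the element realizing it may lie on either side.
  have hbad : ∃ n, (∃ x : L, x ∉ Set.range (algebraMap K L) ∧ (minpoly K x).natDegree = n) ∨
      (∃ x : R, x ∉ Set.range (algebraMap K R) ∧ (minpoly K x).natDegree = n) := by
    rw [not_and_or] at hns
    rcases hns with hns | hns <;> simp only [Function.Surjective, not_forall] at hns <;>
      obtain ⟨x, hx⟩ := hns
    · exact ⟨_, .inl ⟨x, hx, rfl⟩⟩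
    · exact ⟨_, .inr ⟨x, hx, rfl⟩⟩
  have hminL : ∀ x : L, IsIntegral K x → (minpoly K x).natDegree < Nat.find hbad →
      x ∈ Set.range (algebraMap K L) := fun x _ hx => by
    by_contra hcon
    exact Nat.find_min hbad hx (.inl ⟨x, hcon, rfl⟩)
  have hminR : ∀ x : R, IsIntegral K x → (minpoly K x).natDegree < Nat.find hbad →
      x ∈ Set.range (algebraMap K R) := fun x _ hx => by
    by_contra hcon
    exact Nat.find_min hbad hx (.inr ⟨x, hcon, rfl⟩)
  rcases Nat.find_spec hbad with ⟨β, hβ, hdeg⟩ | ⟨β, hβ, hdeg⟩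
  · rw [← hdeg] at hminL hminR
    obtain ⟨β', hβ'⟩ := exists_root_aeval_nonneg_iff hmonoL hmonoR
      (Algebra.IsIntegral.isIntegral β) hβ hminL hminR
    exact ⟨β, β', .inl hβ, fun g => by rw [← hL, ← hR, hβ']⟩
  · rw [← hdeg] at hminL hminR
    obtain ⟨β', hβ'⟩ := exists_root_aeval_nonneg_iff hmonoR hmonoL
      (Algebra.IsIntegral.isIntegral β) hβ hminR hminL
    exact ⟨β', β, .inr hβ, fun g => by rw [← hL, ← hR, hβ']⟩

/-- Two real closed algebraic extensions of a field that induce the same order on it are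
isomorphic. -/
theorem IsRealClosed.nonempty_algEquiv [IsRealClosed L] [IsRealClosed R]
    [Algebra.IsAlgebraic K L] [Algebra.IsAlgebraic K R]
    (h : ∀ k : K, IsSquare (algebraMap K L k) ↔ IsSquare (algebraMap K R k)) :
    Nonempty (L ≃ₐ[K] R) := by
  obtain ⟨G, hG, hmax⟩ := IsSquareGraph.exists_maximal h
  let π₁ : G →ₐ[K] L := (AlgHom.fst K L R).comp G.val
  let π₂ : G →ₐ[K] R := (AlgHom.snd K L R).comp G.val
  have hinj₁ : Function.Injective π₁ := by
    rw [injective_iff_map_eq_zero]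
    intro z hz
    exact Subtype.ext (Prod.ext hz ((hG.eq_zero_iff z.2).1 hz))
  have hinj₂ : Function.Injective π₂ := by
    rw [injective_iff_map_eq_zero]
    intro z hz
    exact Subtype.ext (Prod.ext ((hG.eq_zero_iff z.2).2 hz) hz)
  suffices hsurj : Function.Surjective π₁ ∧ Function.Surjective π₂ from
    ⟨(AlgEquiv.ofBijective π₁ ⟨hinj₁, hsurj.1⟩).symm.trans
      (AlgEquiv.ofBijective π₂ ⟨hinj₂, hsurj.2⟩)⟩
  have : IsDomain G := hinj₁.isDomain π₁.toRingHom
  have : Algebra.IsIntegral K G :=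
    ⟨fun z => (isIntegral_algHom_iff π₁ hinj₁).1 (Algebra.IsIntegral.isIntegral _)⟩
  have hfield : IsField G := isField_of_isIntegral_of_isField' (Field.toIsField K)
  let _ : Field G := hfield.toField
  let _ : Algebra G L := π₁.toRingHom.toAlgebra
  let _ : Algebra G R := π₂.toRingHom.toAlgebra
  have : IsScalarTower K G L := .of_algebraMap_eq' rfl
  have : IsScalarTower K G R := .of_algebraMap_eq' rfl
  have : Algebra.IsIntegral G L := .tower_top K
  have : Algebra.IsIntegral G R := .tower_top K
  by_contra hns
  obtain ⟨β, β', hββ', hsq⟩ :=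
    IsRealClosed.exists_isSquare_aeval_iff (K := G) (fun z => hG z.1 z.2) hns
  have hG' : IsSquareGraph (Algebra.adjoin K (insert (β, β') (G : Set (L × R)))) := by
    intro z hz
    -- Every element of the enlarged algebra is a simultaneous evaluation of one polynomial over
    -- `G`, to which `hsq` applies. The enlarged algebra is thus a square graph and maximality puts
    -- `(β, β')` into `G`.
    suffices ∃ g : G[X], z = (aeval β g, aeval β' g) by
      obtain ⟨g, rfl⟩ := this
      exact hsq g
    induction hz using Algebra.adjoin_induction with
    | mem z hz =>
      rcases hz with rfl | hz
      · exact ⟨X, by simp⟩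
      · exact ⟨C ⟨z, hz⟩, by simp only [aeval_C]; rfl⟩
    | algebraMap k => exact ⟨C (algebraMap K G k), by simp only [aeval_C]; rfl⟩
    | add x y _ _ hx hy =>
      obtain ⟨g, rfl⟩ := hx
      obtain ⟨g', rfl⟩ := hy
      exact ⟨g + g', by simp⟩
    | mul x y _ _ hx hy =>
      obtain ⟨g, rfl⟩ := hx
      obtain ⟨g', rfl⟩ := hy
      exact ⟨g * g', by simp⟩
  have hmem : (β, β') ∈ G :=
    hmax hG' (fun z hz => Algebra.subset_adjoin (Set.mem_insert_of_mem _ hz))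
      (Algebra.subset_adjoin (Set.mem_insert _ _))
  rcases hββ' with hn | hn
  · exact hn ⟨⟨_, hmem⟩, rfl⟩
  · exact hn ⟨⟨_, hmem⟩, rfl⟩

end Uniqueness

section Bound

variable {F : Type*} [Field F] [LinearOrder F] [IsStrictOrderedRing F]

theorem exists_sign_change_of_odd_natDegree {f : F[X]} (hf : Odd f.natDegree) :
    ∃ a b, f.eval a * f.eval b < 0 := by
  have hmono : StrictMono (algebraMap F F) := strictMono_id
  have key : ∀ {g : F[X]}, Odd g.natDegree → 0 < g.leadingCoeff →
      ∃ a b, g.eval a * g.eval b < 0 := by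
    intro g hg hpos
    obtain ⟨M, δ, hδ, hM⟩ := exists_forall_le_aeval (L := F) hmono g hpos
    obtain ⟨M', δ', hδ', hM'⟩ := exists_forall_le_aeval (L := F) hmono (-(g.comp (-X))) (by
      rw [leadingCoeff_neg, leadingCoeff_comp (by simp), leadingCoeff_neg, leadingCoeff_X,
        hg.neg_one_pow]
      simpa using hpos)
    have h1 := hM M le_rfl
    have h2 := hM' M' le_rfl
    simp only [Algebra.algebraMap_self, RingHom.id_apply, coe_aeval_eq_eval, eval_neg,
      eval_comp, eval_X] at h1 h2
    exact ⟨M, -M', mul_neg_of_pos_of_neg (hδ.trans_le h1) (by linarith)⟩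
  have hf0 : f.leadingCoeff ≠ 0 := by
    rw [leadingCoeff_ne_zero]
    rintro rfl
    simp at hf
  rcases lt_or_gt_of_ne hf0 with h | h
  · obtain ⟨a, b, hab⟩ := key (g := -f) (by rwa [natDegree_neg])
      (by rw [leadingCoeff_neg]; linarith)
    exact ⟨a, b, by simpa using hab⟩
  · exact key hf h

end Bound

/-! ### Existence of the real closure of an ordered field. -/

section Existence

variable {K Ω : Type*} [Field K] [Field Ω] [Algebra K Ω]

/-- The elements `t x²` with `t` in a given cone and `x` in a given intermediate field. -/
def weightedSquares (P : RingPreordering K) (F : IntermediateField K Ω) : Submonoid Ω where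
  carrier := {y | ∃ t ∈ P, ∃ x ∈ F, y = algebraMap K Ω t * (x * x)}
  one_mem' := ⟨1, one_mem P, 1, one_mem F, by simp⟩
  mul_mem' := by
    rintro _ _ ⟨t, ht, x, hx, rfl⟩ ⟨t', ht', x', hx', rfl⟩
    exact ⟨t * t', mul_mem ht ht', x * x', mul_mem hx hx', by rw [map_mul]; ring⟩

/-- The order given by `P` can be extended to the intermediate field `F`. -/
def IsRealOver (P : RingPreordering K) (F : IntermediateField K Ω) : Prop :=
  (-1 : Ω) ∉ (weightedSquares P F).subsemiringClosure

theorem isRealOver_bot (P : RingPreordering K) : IsRealOver P (⊥ : IntermediateField K Ω) := by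
  have key : ∀ z ∈ (weightedSquares P (⊥ : IntermediateField K Ω)).subsemiringClosure,
      ∃ t ∈ P, z = algebraMap K Ω t := by
    intro z hz
    rw [Submonoid.subsemiringClosure_mem] at hz
    induction hz using AddSubmonoid.closure_induction with
    | mem z h =>
      obtain ⟨t, ht, x, hx, rfl⟩ := h
      obtain ⟨k, rfl⟩ := IntermediateField.mem_bot.1 hx
      exact ⟨t * (k * k), mul_mem ht (P.mul_self_mem k), by simp⟩
    | zero => exact ⟨0, zero_mem P, by simp⟩
    | add x y _ _ hx hy =>
      obtain ⟨s, hs, rfl⟩ := hx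
      obtain ⟨t, ht, rfl⟩ := hy
      exact ⟨s + t, add_mem hs ht, by simp⟩
  intro h
  obtain ⟨t, ht, h⟩ := key _ h
  have : t = -1 := (algebraMap K Ω).injective (by simp [← h])
  exact P.neg_one_notMem (this ▸ ht)

theorem exists_maximal_isRealOver (P : RingPreordering K) :
    ∃ F : IntermediateField K Ω, Maximal (IsRealOver P) F := by
  obtain ⟨F, -, hF⟩ := zorn_le_nonempty₀ {F : IntermediateField K Ω | IsRealOver P F}
    (fun c hc hchain F₀ hF₀ => by
      refine ⟨sSup c, ?_, fun F hF => le_sSup hF⟩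
      have : Nonempty c := ⟨⟨F₀, hF₀⟩⟩
      have hdir : Directed (· ≤ ·) (fun F : c => (F : IntermediateField K Ω)) :=
        hchain.directedOn.directed_val
      have key : ∀ z ∈ (weightedSquares P (sSup c)).subsemiringClosure,
          ∃ F ∈ c, z ∈ (weightedSquares P F).subsemiringClosure := by
        intro z hz
        rw [Submonoid.subsemiringClosure_mem] at hz
        induction hz using AddSubmonoid.closure_induction with
        | mem z h =>
          obtain ⟨t, ht, x, hx, rfl⟩ := h
          rw [sSup_eq_iSup', ← SetLike.mem_coe, IntermediateField.coe_iSup_of_directed hdir,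
            Set.mem_iUnion] at hx
          obtain ⟨F, hF⟩ := hx
          exact ⟨F, F.2, AddSubmonoid.subset_closure ⟨t, ht, x, hF, rfl⟩⟩
        | zero => exact ⟨F₀, hF₀, zero_mem _⟩
        | add x y _ _ hx hy =>
          obtain ⟨F, hF, hx⟩ := hx
          obtain ⟨F', hF', hy⟩ := hy
          have hmono : ∀ {E E' : IntermediateField K Ω}, E ≤ E' → ∀ {z : Ω},
              z ∈ (weightedSquares P E).subsemiringClosure →
              z ∈ (weightedSquares P E').subsemiringClosure := by
            intro E E' hE z hz
            refine AddSubmonoid.closure_mono ?_ hz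
            rintro _ ⟨t, ht, x, hx, rfl⟩
            exact ⟨t, ht, x, hE hx, rfl⟩
          rcases hchain.total hF hF' with h | h
          · exact ⟨F', hF', add_mem (hmono h hx) hy⟩
          · exact ⟨F, hF, add_mem hx (hmono h hy)⟩
      intro h
      obtain ⟨F, hF, h⟩ := key _ h
      exact hc hF h) ⊥ (isRealOver_bot P)
  exact ⟨F, hF⟩

variable [IsAlgClosed Ω] [Algebra.IsAlgebraic K Ω]

/-- Adjoining a root `y` of a sign-changing irreducible factor `g` keeps the field real over `P`:
otherwise `g` would divide some `1 + w` with `w` a weighted sum of squares. Maximality then puts `y`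
into `F`. -/
theorem exists_root_of_maximal_isRealOver {P : RingPreordering K} {F : IntermediateField K Ω}
    (hF : Maximal (IsRealOver P) F) [LinearOrder F] [IsStrictOrderedRing F]
    (hP : ∀ t ∈ P, 0 ≤ algebraMap K F t) {f : F[X]} {a b : F}
    (hf : f.eval a * f.eval b < 0) : ∃ x, f.IsRoot x := by
  obtain ⟨g, hirr, hgf, hg⟩ := exists_irreducible_dvd_of_sign_change hf
  obtain ⟨y, hy⟩ := IsAlgClosed.exists_aeval_eq_zero Ω g hirr.degree_pos.ne'
  have hintegral : IsIntegral F y := (Algebra.IsIntegral.isIntegral (R := K) y).tower_top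
  have hmin : g ∣ minpoly F y :=
    ((minpoly.irreducible hintegral).associated_of_dvd hirr (minpoly.dvd F y hy)).symm.dvd
  have hreal : IsRealOver P
      (IntermediateField.restrictScalars K (IntermediateField.adjoin F {y})) := by
    have key : ∀ z ∈ (weightedSquares P (IntermediateField.restrictScalars K
        (IntermediateField.adjoin F {y}))).subsemiringClosure,
        ∃ w ∈ weightedSumSqPolynomial F, z = aeval y w := by
      intro z hz
      rw [Submonoid.subsemiringClosure_mem] at hz
      induction hz using AddSubmonoid.closure_induction with
      | mem z h =>
        obtain ⟨t, ht, x, hx, rfl⟩ := h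
        rw [IntermediateField.mem_restrictScalars, ← IntermediateField.mem_toSubalgebra,
          IntermediateField.adjoin_simple_toSubalgebra_of_isAlgebraic hintegral.isAlgebraic,
          Algebra.adjoin_singleton_eq_range_aeval] at hx
        obtain ⟨g, rfl⟩ := hx
        refine ⟨C (algebraMap K F t) * (g * g),
          AddSubmonoid.subset_closure ⟨_, hP t ht, g, rfl⟩, ?_⟩
        simp only [map_mul, aeval_C, ← IsScalarTower.algebraMap_apply]
        rfl
      | zero => exact ⟨0, zero_mem _, by simp⟩
      | add x y _ _ hx hy =>
        obtain ⟨s, hs, rfl⟩ := hx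
        obtain ⟨t, ht, rfl⟩ := hy
        exact ⟨s + t, add_mem hs ht, by simp⟩
    intro h
    obtain ⟨w, hw, h⟩ := key _ h
    refine not_dvd_one_add_of_sign_change hg hw (hmin.trans (minpoly.dvd F y ?_))
    simp [← h]
  have hle : F ≤ IntermediateField.restrictScalars K (IntermediateField.adjoin F {y}) := by
    intro x hx
    exact (IntermediateField.adjoin F {y}).algebraMap_mem ⟨x, hx⟩
  have hyF : y ∈ F := hF.2 hreal hle (IntermediateField.mem_adjoin_simple_self F y)
  refine ⟨⟨y, hyF⟩, eval_eq_zero_of_dvd_of_eval_eq_zero hgf ?_⟩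
  apply (algebraMap F Ω).injective
  rw [← aeval_algebraMap_apply_eq_algebraMap_eval, map_zero]
  exact hy

end Existence

/-- Real closures of ordered fields exist. -/
theorem exists_realClosure {K : Type u} [Field K] (P : RingPreordering K) :
    ∃ (R : Type u) (_ : Field R) (_ : Algebra K R), IsRealClosed R ∧ Algebra.IsAlgebraic K R ∧
      ∀ t ∈ P, IsSquare (algebraMap K R t) := by
  obtain ⟨F, hF⟩ := exists_maximal_isRealOver (Ω := AlgebraicClosure K) P
  let P₀ : RingPreordering F := RingPreordering.mk'
    {x | (x : AlgebraicClosure K) ∈ (weightedSquares P F).subsemiringClosure}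
    (fun {x y} hx hy => by
      rw [Set.mem_ofPred_eq] at *
      rw [AddMemClass.coe_add]
      exact add_mem hx hy)
    (fun {x y} hx hy => by
      rw [Set.mem_ofPred_eq] at *
      rw [MulMemClass.coe_mul]
      exact mul_mem hx hy)
    (fun x => AddSubmonoid.subset_closure ⟨1, one_mem P, x, x.2, by simp⟩) (fun h => hF.1 h)
  obtain ⟨Q, hPQ, hQ⟩ := P₀.exists_le_mem_or_neg_mem
  obtain ⟨_, _, hnonneg⟩ := exists_linearOrder_of_ringPreordering Q hQ
  have hP : ∀ t ∈ P, 0 ≤ algebraMap K F t := fun t ht =>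
    (hnonneg _).2 (hPQ (AddSubmonoid.subset_closure ⟨t, ht, 1, one_mem F, by simp⟩))
  have hsq : ∀ {x : F}, 0 ≤ x → IsSquare x := by
    intro x hx
    rcases hx.eq_or_lt with rfl | hpos
    · exact ⟨0, by simp⟩
    -- The values at `0` and `x + 1` are `-x < 0` and `x² + x + 1 > 0`.
    · obtain ⟨y, hy⟩ := exists_root_of_maximal_isRealOver hF hP (f := X * X - C x) (a := 0)
        (b := x + 1) (by
          have h1 : 0 < (x + 1) * (x + 1) - x := by nlinarith
          simpa using mul_pos hpos h1)
      exact ⟨y, by simpa [sub_eq_zero, eq_comm] using hy⟩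
  refine ⟨F, inferInstance, inferInstance, IsRealClosed.of_linearOrderedField hsq
    (fun {f} hf => ?_), inferInstance, fun t ht => hsq (hP t ht)⟩
  obtain ⟨a, b, hab⟩ := exists_sign_change_of_odd_natDegree hf
  exact exists_root_of_maximal_isRealOver hF hP hab

/-! ### Von Neumann regular rings, Baer rings and essential extensions. -/

section Regular

variable {A : Type u} [CommRing A]

theorem IsVonNeumannRegular.exists_idempotent (hA : IsVonNeumannRegular A) (a : A) :
    ∃ e b : A, IsIdempotentElem e ∧ a * b = e ∧ a * e = a := by
  obtain ⟨b, hb⟩ := hA a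
  refine ⟨a * b, b, ?_, rfl, by linear_combination hb⟩
  unfold IsIdempotentElem
  linear_combination b * hb

theorem IsVonNeumannRegular.isMaximal (hA : IsVonNeumannRegular A) (p : Ideal A) [hp : p.IsPrime] :
    p.IsMaximal := by
  rw [Ideal.isMaximal_iff]
  refine ⟨(Ideal.ne_top_iff_one p).1 hp.ne_top, fun J x hpJ hxp hxJ => ?_⟩
  obtain ⟨b, hb⟩ := hA x
  have h1 : x * (x * b - 1) ∈ p := by
    rw [show x * (x * b - 1) = 0 by linear_combination hb]
    exact p.zero_mem
  have h2 := hpJ ((hp.mem_or_mem h1).resolve_left hxp)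
  have h3 := J.sub_mem (J.mul_mem_right b hxJ) h2
  rwa [sub_sub_cancel] at h3

theorem IsVonNeumannRegular.exists_idempotent_of_mem (hA : IsVonNeumannRegular A) {p : Ideal A}
    [hp : p.IsPrime] {x : A} (hx : x ∈ p) : ∃ e : A, IsIdempotentElem e ∧ e ∉ p ∧ e * x = 0 := by
  obtain ⟨e, b, he, hb, hxe⟩ := hA.exists_idempotent x
  refine ⟨1 - e, he.one_sub, fun h => ?_, by linear_combination -hxe⟩
  refine hp.ne_top ((Ideal.eq_top_iff_one p).2 ?_)
  have := p.add_mem h (hb ▸ p.mul_mem_right b hx)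
  rwa [sub_add_cancel] at this

/-- All primes of `D` are maximal by integrality, and a reduced ring of dimension zero is von
Neumann regular. -/
theorem IsVonNeumannRegular.of_isIntegral {D : Type u} [CommRing D] [Algebra A D] [IsReduced D]
    [Algebra.IsIntegral A D] (hA : IsVonNeumannRegular A) : IsVonNeumannRegular D := by
  have hmax : ∀ q : Ideal D, q.IsPrime → q.IsMaximal := fun q hq =>
    Ideal.isMaximal_of_isIntegral_of_isMaximal_comap (R := A) q (hA.isMaximal _)
  intro d
  have htop : Ideal.span {d} ⊔ LinearMap.ker (LinearMap.mulRight D d) = ⊤ := by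
    by_contra hne
    obtain ⟨m, hm, hle⟩ := Ideal.exists_le_maximal _ hne
    have hdm : d ∈ m := hle (Ideal.mem_sup_left (Ideal.mem_span_singleton_self d))
    -- By reducedness, `t * d ^ n = 0` forces `t * d = 0`, so `t` annihilates `d` and lies in `m`.
    -- Hence some prime inside `m` avoids `d`; being maximal it equals `m`, which contains `d`.
    have hzero : (0 : D) ∉ m.primeCompl ⊔ Submonoid.powers d := by
      intro h
      obtain ⟨t, ht, _, ⟨n, rfl⟩, htn⟩ := Submonoid.mem_sup.1 h
      have hnil : IsNilpotent (t * d) := ⟨n + 1, by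
        linear_combination t ^ n * d * htn⟩
      exact ht (hle (Ideal.mem_sup_right (LinearMap.mem_ker.2 hnil.eq_zero)))
    obtain ⟨q, hq, -, hdisj⟩ := Ideal.exists_le_prime_disjoint ⊥
      (m.primeCompl ⊔ Submonoid.powers d) (Set.disjoint_left.2 fun x hx hx' => hzero
        ((Submodule.mem_bot D).1 hx ▸ hx'))
    have hqm : q ≤ m := fun x hx => by
      by_contra hxm
      exact Set.disjoint_left.1 hdisj hx ((le_sup_left : m.primeCompl ≤ _) hxm)
    have hdq : d ∈ q := ((hmax q hq).eq_of_le hm.ne_top hqm) ▸ hdm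
    exact Set.disjoint_left.1 hdisj hdq
      ((le_sup_right : Submonoid.powers d ≤ _) (Submonoid.mem_powers d))
  have h1 : (1 : D) ∈ Ideal.span {d} ⊔ LinearMap.ker (LinearMap.mulRight D d) :=
    htop ▸ Submodule.mem_top
  obtain ⟨y, hy, z, hz, hyz⟩ := Submodule.mem_sup.1 h1
  obtain ⟨x, rfl⟩ := Ideal.mem_span_singleton.1 hy
  have hz' : z * d = 0 := hz
  exact ⟨x, by linear_combination d * hyz - hz'⟩

theorem IsEssentialExtension.eq_zero_of_forall {C : Type u} [CommRing C] [Algebra A C]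
    (hess : IsEssentialExtension A C) {x : C}
    (h : ∀ (a : A) (z : C), algebraMap A C a = z * x → a = 0) : x = 0 := by
  by_contra hne
  refine hess.2 (Ideal.span {x}) (by simpa using hne) ((Submodule.eq_bot_iff _).2 fun a ha => ?_)
  obtain ⟨z, hz⟩ := Ideal.mem_span_singleton'.1 (Ideal.mem_comap.1 ha)
  exact h a z hz.symm

/-- The idempotents of an essential extension of a Baer ring belong to that ring. -/
theorem IsBaerRing.exists_algebraMap_eq {E : Type u} [CommRing E] [Algebra A E]
    (hA : IsBaerRing A) (hE : IsEssentialExtension A E) {ε : E} (hε : IsIdempotentElem ε) :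
    ∃ e : A, IsIdempotentElem e ∧ algebraMap A E e = ε := by
  have hinj := hE.1
  -- The target is `ε = 1 - u`. It follows from `ε * u = 0` and `(1 - ε) * (1 - u) = 0`, each of
  -- which essentiality reduces to multiples lying in `A`.
  obtain ⟨u, hu, hann⟩ := hA {a | algebraMap A E a * ε = algebraMap A E a}
  have hmem : ∀ x : A, (∀ s : A, algebraMap A E s * ε = algebraMap A E s → x * s = 0) ↔
      x * u = x := by
    intro x
    rw [show x * u = x ↔ x ∈ (Ideal.span {u} : Set A) from ?_, ← hann]
    · rfl
    · rw [SetLike.mem_coe, Ideal.mem_span_singleton']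
      exact ⟨fun h => ⟨x, h⟩, by rintro ⟨y, rfl⟩; rw [mul_assoc, hu]⟩
  have hε' : ε * ε = ε := hε
  have hu' : algebraMap A E u * algebraMap A E u = algebraMap A E u := by rw [← map_mul, hu]
  have h1 : ε * algebraMap A E u = 0 := by
    refine hE.eq_zero_of_forall fun a x hx => ?_
    have haS : algebraMap A E a * ε = algebraMap A E a := by
      rw [hx]
      linear_combination x * algebraMap A E u * hε'
    have hau : a * u = a := hinj (by
      rw [map_mul, hx]
      linear_combination x * ε * hu')
    rw [← hau, mul_comm]
    exact (hmem u).2 hu a haS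
  have h2 : (1 - ε) * (1 - algebraMap A E u) = 0 := by
    refine hE.eq_zero_of_forall fun a x hx => ?_
    have haε : algebraMap A E a * ε = 0 := by
      rw [hx]
      linear_combination -x * (1 - algebraMap A E u) * hε'
    have hau : a * u = a := (hmem a).1 fun s hs => hinj (by
      rw [map_mul, ← hs, map_zero]
      linear_combination algebraMap A E s * haε)
    have hau' : a * u = 0 := hinj (by
      rw [map_mul, map_zero, hx]
      linear_combination -x * (1 - ε) * hu')
    rw [← hau, hau']
  exact ⟨1 - u, hu.one_sub, by rw [map_sub, map_one]; linear_combination h2 - h1⟩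

theorem IsEssentialExtension.trans {C D : Type u} [CommRing C] [CommRing D] [Algebra A C]
    [Algebra C D] [Algebra A D] [IsScalarTower A C D] (h : IsEssentialExtension A C)
    (h' : IsEssentialExtension C D) : IsEssentialExtension A D := by
  refine ⟨?_, fun I hI => ?_⟩
  · rw [IsScalarTower.algebraMap_eq A C D]
    exact h'.1.comp h.1
  · rw [IsScalarTower.algebraMap_eq A C D, ← Ideal.comap_comap]
    exact h.2 _ (h'.2 I hI)

/-- An idempotent `e` outside `p` with `e * (1 + s) = 0` would give a vanishing sum of squares `e² +
e² * s`, hence `e = 0`. This makes every residue field semireal. -/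
theorem IsVonNeumannRegular.one_add_notMem_of_isSumSq (hA : IsVonNeumannRegular A)
    (hreal : IsFormallyReal A) (p : Ideal A) [hp : p.IsPrime] {s : A} (hs : IsSumSq s) :
    1 + s ∉ p := by
  intro hmem
  obtain ⟨e, he, hep, h⟩ := hA.exists_idempotent_of_mem hmem
  apply hep
  have he' : e * e = e := he
  have h1 : e * e = 0 := IsFormallyReal.eq_zero_of_add_right (s₂ := e * e * s)
    (IsSumSq.mul_self e) ((IsSumSq.mul_self e).mul hs) (by linear_combination h + (1 + s) * he')
  rw [← he', h1]
  exact p.zero_mem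

theorem IsSumSq.exists_lift {D : Type*} [CommRing D] {f : A →+* D} (hf : Function.Surjective f)
    {s : D} (hs : IsSumSq s) : ∃ t : A, IsSumSq t ∧ f t = s := by
  induction hs with
  | zero => exact ⟨0, .zero, map_zero f⟩
  | sq_add a _ ih =>
    obtain ⟨t, ht, rfl⟩ := ih
    obtain ⟨b, rfl⟩ := hf a
    exact ⟨b * b + t, .sq_add b ht, by simp⟩

theorem IsVonNeumannRegular.isSemireal_quotient (hA : IsVonNeumannRegular A)
    (hreal : IsFormallyReal A) (p : Ideal A) [hp : p.IsPrime] : IsSemireal (A ⧸ p) where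
  one_add_ne_zero hs h := by
    obtain ⟨t, ht, rfl⟩ := hs.exists_lift Ideal.Quotient.mk_surjective
    rw [← map_one (Ideal.Quotient.mk p), ← map_add, Ideal.Quotient.eq_zero_iff_mem] at h
    exact hA.one_add_notMem_of_isSumSq hreal p ht h

end Regular

theorem IsRealClosed.surjective_algebraMap {k L : Type*} [Field k] [Field L] [Algebra k L]
    [IsRealClosed k] [Algebra.IsIntegral k L] (h : ∀ i : L, i * i ≠ -1) :
    Function.Surjective (algebraMap k L) := by
  intro x
  have : FiniteDimensional k (IntermediateField.adjoin k {x}) :=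
    IntermediateField.adjoin.finiteDimensional (Algebra.IsIntegral.isIntegral x)
  have h1 : Module.finrank k (IntermediateField.adjoin k {x}) = 1 :=
    IsRealClosed.finrank_eq_one fun i hi => h i (congrArg Subtype.val hi)
  rw [IntermediateField.finrank_eq_one_iff, IntermediateField.adjoin_simple_eq_bot_iff] at h1
  exact IntermediateField.mem_bot.1 h1

/-! ### Real closed residue fields imply real closed `*`. -/

section Criterion

variable {A D : Type u} [CommRing A] [CommRing D] [Algebra A D]

/-- An essential integral real extension of a von Neumann regular Baer ring is real closed `*`
if its residue fields are real closed. -/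
theorem isRealClosedStar_of_isRealClosed_quotient [Algebra.IsIntegral A D]
    (hA : IsVonNeumannRegular A) (hbaer : IsBaerRing A) (hess : IsEssentialExtension A D)
    (hreal : IsFormallyReal D)
    (hres : ∀ (q : Ideal D) [q.IsMaximal], @IsRealClosed (D ⧸ q) (Ideal.Quotient.field q)) :
    IsRealClosedStar D := by
  refine ⟨hreal, fun D' _ _ hreal' hess' hintegral' x => ?_⟩
  let _ : Algebra A D' := ((algebraMap D D').comp (algebraMap A D)).toAlgebra
  have : IsScalarTower A D D' := .of_algebraMap_eq' rfl
  have : Algebra.IsIntegral A D' := .trans D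
  have hess'' := hess.trans hess'
  have hD : IsVonNeumannRegular D := hA.of_isIntegral
  have hD' : IsVonNeumannRegular D' := hA.of_isIntegral
  -- `N` consists of the `a` with `a * x` in `D`. If it were proper, then at a prime `Q` of `D'`
  -- above it `x` would agree with some `c` in `D`, because the real closed field `D/(Q ∩ D)` has no
  -- proper real algebraic extension. An idempotent of `A` outside `Q` killing `x - c` lies in `N`,
  -- a contradiction.
  let N : Ideal A := Submodule.comap (LinearMap.toSpanSingleton A D' x)
    (LinearMap.range (IsScalarTower.toAlgHom A D D').toLinearMap)
  have hN : ∀ a : A, a ∈ N ↔ ∃ c, algebraMap D D' c = algebraMap A D' a * x := by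
    intro a
    rw [← Algebra.smul_def]
    rfl
  suffices h : N = ⊤ by
    obtain ⟨c, hc⟩ := (hN 1).1 (h ▸ Submodule.mem_top)
    exact ⟨c, by simpa using hc⟩
  by_contra hne
  obtain ⟨p, hp, hNp⟩ := Ideal.exists_le_maximal N hne
  obtain ⟨Q, hQ, hQp⟩ := Ideal.exists_ideal_over_maximal_of_isIntegral (S := D') p
    (by rw [(RingHom.injective_iff_ker_eq_bot _).1 hess''.1]; exact bot_le)
  have : (Q.under D).IsMaximal := hD.isMaximal _
  let _ : Field (D ⧸ Q.under D) := Ideal.Quotient.field _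
  let _ : Field (D' ⧸ Q) := Ideal.Quotient.field _
  have : IsRealClosed (D ⧸ Q.under D) := hres _
  have hsurj : Function.Surjective (algebraMap (D ⧸ Q.under D) (D' ⧸ Q)) := by
    refine IsRealClosed.surjective_algebraMap fun i hi => ?_
    obtain ⟨y, rfl⟩ := Ideal.Quotient.mk_surjective i
    refine hD'.one_add_notMem_of_isSumSq hreal' Q (IsSumSq.mul_self y) ?_
    rw [← Ideal.Quotient.eq_zero_iff_mem, map_add, map_mul, hi, map_one, add_neg_cancel]
  obtain ⟨c, hc⟩ := hsurj (Ideal.Quotient.mk Q x)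
  obtain ⟨c, rfl⟩ := Ideal.Quotient.mk_surjective c
  have hmem : x - algebraMap D D' c ∈ Q := by
    rw [← Ideal.Quotient.eq]
    exact hc.symm
  obtain ⟨ε, hε, hεQ, hzero⟩ := hD'.exists_idempotent_of_mem hmem
  obtain ⟨e, he, rfl⟩ := hbaer.exists_algebraMap_eq hess'' hε
  refine hεQ (Ideal.mem_comap.1 (hQp ▸ hNp ((hN e).2 ⟨algebraMap A D e * c, ?_⟩)))
  rw [map_mul, ← IsScalarTower.algebraMap_apply]
  linear_combination -hzero

end Criterion

/-! ### Quotients of products of real closed fields. -/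

section Pointwise

/-- The properties of quotients of products of real closed fields that make the residue fields of
integrally closed subrings real closed. -/
structure IsPointwiseRealClosed (E : Type*) [CommRing E] : Prop where
  isFormallyReal : IsFormallyReal E
  exists_idempotent : ∀ x : E, ∃ ε u v : E,
    IsIdempotentElem ε ∧ ε * x = u * u ∧ (1 - ε) * x = -(v * v)
  exists_isRoot : ∀ f : E[X], f.Monic → Odd f.natDegree → ∃ x, f.IsRoot x
  isSquare_add : ∀ x y : E, IsSquare x → IsSquare y → IsSquare (x + y)

theorem IsRealClosed.isSquare_add {F : Type*} [Field F] [IsRealClosed F] {x y : F}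
    (hx : IsSquare x) (hy : IsSquare y) : IsSquare (x + y) := by
  obtain ⟨_, _, h⟩ := IsRealClosed.exists_linearOrder (F := F)
  rw [← h] at *
  exact add_nonneg hx hy

theorem Pi.isSquare_of_forall {ι : Type*} {R : ι → Type*} [∀ i, Mul (R i)] {x : ∀ i, R i}
    (h : ∀ i, IsSquare (x i)) : IsSquare x := by
  choose y hy using h
  exact ⟨y, funext hy⟩

theorem IsSquare.exists_lift {A D : Type*} [CommRing A] [CommRing D] {f : A →+* D}
    (hf : Function.Surjective f) {s : D} (hs : IsSquare s) : ∃ t : A, IsSquare t ∧ f t = s := by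
  obtain ⟨a, rfl⟩ := hs
  obtain ⟨b, rfl⟩ := hf a
  exact ⟨b * b, ⟨b, rfl⟩, map_mul f b b⟩

theorem IsPointwiseRealClosed.pi_quotient {ι : Type*} {R : ι → Type*} [∀ i, Field (R i)]
    [∀ i, IsRealClosed (R i)] (I : Ideal (∀ i, R i)) :
    IsPointwiseRealClosed ((∀ i, R i) ⧸ I) where
  isFormallyReal := by
    refine .of_eq_zero_of_eq_zero_of_mul_self_add fun {s a} hs h => ?_
    obtain ⟨t, ht, rfl⟩ := hs.exists_lift Ideal.Quotient.mk_surjective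
    obtain ⟨b, rfl⟩ := Ideal.Quotient.mk_surjective a
    rw [← map_mul, ← map_add, Ideal.Quotient.eq_zero_iff_mem] at h
    rw [Ideal.Quotient.eq_zero_iff_mem]
    -- The inverse is coordinatewise with `0⁻¹ = 0`; where `b² + t` vanishes, so does `b`. Hence `b`
    -- is a multiple of `b² + t`, which lies in `I`.
    have hb : b = b * (b * b + t)⁻¹ * (b * b + t) := by
      funext i
      by_cases h0 : b i * b i + t i = 0
      · have hbi : b i = 0 := by
          obtain ⟨_, _, -⟩ := IsRealClosed.exists_linearOrder (F := R i)
          have hti : 0 ≤ t i := by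
            clear h h0 hs
            induction ht with
            | zero => exact le_rfl
            | sq_add a _ ih => exact add_nonneg (mul_self_nonneg (a i)) ih
          exact mul_self_eq_zero.1
            ((add_eq_zero_iff_of_nonneg (mul_self_nonneg (b i)) hti).1 h0).1
        simp [hbi]
      · simp only [Pi.mul_apply, Pi.inv_apply, Pi.add_apply]
        rw [mul_assoc, inv_mul_cancel₀ h0, mul_one]
    rw [hb]
    exact I.mul_mem_left _ h
  exists_idempotent x := by
    classical
    obtain ⟨x, rfl⟩ := Ideal.Quotient.mk_surjective x
    have h : ∀ i, ∃ ε u v : R i, ε * ε = ε ∧ ε * x i = u * u ∧ (1 - ε) * x i = -(v * v) := by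
      intro i
      rcases IsRealClosed.isSquare_or_isSquare_neg (x i) with ⟨u, hu⟩ | ⟨v, hv⟩
      · exact ⟨1, u, 0, by simp, by simpa using hu, by simp⟩
      · exact ⟨0, 0, v, by simp, by simp, by simp [← hv]⟩
    choose ε u v h1 h2 h3 using h
    refine ⟨Ideal.Quotient.mk I ε, Ideal.Quotient.mk I u, Ideal.Quotient.mk I v, ?_, ?_, ?_⟩
    · rw [IsIdempotentElem, ← map_mul]
      exact congrArg _ (funext h1)
    · rw [← map_mul, ← map_mul]
      exact congrArg _ (funext h2)
    · rw [← map_one (Ideal.Quotient.mk I), ← map_sub, ← map_mul, ← map_mul, ← map_neg]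
      exact congrArg _ (funext h3)
  exists_isRoot f hf hodd := by
    obtain ⟨g, rfl, hdeg, hg⟩ := lifts_and_natDegree_eq_and_monic
      (f := Ideal.Quotient.mk I) (p := f) (by
        rw [lifts_iff_coeff_lifts]
        exact fun n => Ideal.Quotient.mk_surjective _) hf
    have h : ∀ i, ∃ r : R i, (g.map (Pi.evalRingHom R i)).IsRoot r := fun i =>
      IsRealClosed.exists_isRoot_of_odd_natDegree (by rwa [hg.natDegree_map, hdeg])
    choose r hr using h
    have hr0 : g.eval r = 0 := by
      funext i
      have := hr i
      rw [IsRoot.def, eval_map] at this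
      rw [Pi.zero_apply, ← this]
      exact (eval₂_at_apply (Pi.evalRingHom R i) r).symm
    exact ⟨Ideal.Quotient.mk I r, by rw [IsRoot.def, eval_map, eval₂_at_apply, hr0, map_zero]⟩
  isSquare_add x y hx hy := by
    obtain ⟨x, hx', rfl⟩ := hx.exists_lift Ideal.Quotient.mk_surjective
    obtain ⟨y, hy', rfl⟩ := hy.exists_lift Ideal.Quotient.mk_surjective
    rw [← map_add]
    refine IsSquare.map (Ideal.Quotient.mk I) (Pi.isSquare_of_forall fun i => ?_)
    exact IsRealClosed.isSquare_add (hx'.map (Pi.evalRingHom R i)) (hy'.map (Pi.evalRingHom R i))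

end Pointwise

/-! ### The integral closure as a real closure `*`. -/

section IntegralClosure

theorem IsFormallyReal.of_injective {D E : Type*} [CommRing D] [CommRing E] (hE : IsFormallyReal E)
    (f : D →+* E) (hf : Function.Injective f) : IsFormallyReal D := by
  refine .of_eq_zero_of_eq_zero_of_mul_self_add fun {s a} hs h => hf ?_
  have hs' : IsSumSq (f s) := by
    clear h
    induction hs with
    | zero => simp
    | sq_add a _ ih =>
      rw [map_add, map_mul]
      exact .sq_add _ ih
  have h' := IsFormallyReal.eq_zero_of_add_right (IsSumSq.mul_self (f a)) hs'
    (by rw [← map_mul, ← map_add, h, map_zero])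
  have hnil : IsNilpotent (f a) := ⟨2, by rw [sq, h']⟩
  rw [map_zero, hnil.eq_zero]

variable {A E : Type u} [CommRing A] [CommRing E] [Algebra A E]

/-- A nonzero ideal of the integral closure contains a nonzero idempotent by regularity, and that
idempotent belongs to `A`. -/
theorem IsEssentialExtension.integralClosure (hA : IsVonNeumannRegular A) (hbaer : IsBaerRing A)
    (hess : IsEssentialExtension A E) [IsReduced E] :
    IsEssentialExtension A (integralClosure A E) := by
  have : IsReduced (_root_.integralClosure A E) :=
    isReduced_of_injective (_root_.integralClosure A E).val Subtype.val_injective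
  have hD : IsVonNeumannRegular (_root_.integralClosure A E) := hA.of_isIntegral
  refine ⟨fun x y h => hess.1 (congrArg Subtype.val h), fun I hI hbot => hI ?_⟩
  rw [Submodule.eq_bot_iff] at hbot ⊢
  intro x hx
  obtain ⟨ε, b, hε, hb, hxε⟩ := hD.exists_idempotent x
  obtain ⟨e, he, hee⟩ := hbaer.exists_algebraMap_eq hess
    (show IsIdempotentElem (ε : E) from congrArg Subtype.val hε)
  have hee' : algebraMap A (_root_.integralClosure A E) e = ε := Subtype.ext hee
  have : e = 0 := hbot e (by
    rw [Ideal.mem_comap, hee', ← hb]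
    exact I.mul_mem_right _ hx)
  rw [← hxε, ← hee', this, map_zero, mul_zero]

theorem IsPointwiseRealClosed.isRealClosed_quotient (hE : IsPointwiseRealClosed E)
    (hA : IsVonNeumannRegular A) (hbaer : IsBaerRing A) (hess : IsEssentialExtension A E)
    (q : Ideal (integralClosure A E)) [hq : q.IsMaximal] :
    @IsRealClosed (integralClosure A E ⧸ q) (Ideal.Quotient.field q) := by
  have hE₁ := hE.isFormallyReal
  have hDreal : IsFormallyReal (integralClosure A E) :=
    hE₁.of_injective (integralClosure A E).val.toRingHom Subtype.val_injective
  have hD : IsVonNeumannRegular (integralClosure A E) := hA.of_isIntegral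
  let _ : Field (integralClosure A E ⧸ q) := Ideal.Quotient.field q
  have hsemi : IsSemireal (integralClosure A E ⧸ q) := hD.isSemireal_quotient hDreal q
  refine { hsemi with isSquare_or_isSquare_neg := fun x => ?_,
                      exists_isRoot_of_odd_natDegree := fun {f} hf => ?_ }
  · obtain ⟨x, rfl⟩ := Ideal.Quotient.mk_surjective x
    obtain ⟨ε, u, v, hε, hu, hv⟩ := hE.exists_idempotent x
    -- The sign of `x` is split by an idempotent of `A`. The roots `u` and `v` are integral because
    -- their squares are, and modulo `q` one of `e`, `1 - e` vanishes, leaving `-x` or `x` a square.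
    obtain ⟨e, he, rfl⟩ := hbaer.exists_algebraMap_eq hess hε
    have hsq : ∀ {w : E}, w * w ∈ integralClosure A E → w ∈ integralClosure A E := by
      intro w hw
      exact IsIntegral.of_pow two_pos (by rwa [sq])
    have huD : u ∈ integralClosure A E :=
      hsq (hu ▸ mul_mem ((integralClosure A E).algebraMap_mem e) x.2)
    have hvD : v ∈ integralClosure A E := by
      refine hsq ?_
      rw [← neg_neg (v * v), ← hv]
      exact neg_mem (mul_mem (sub_mem (one_mem _)
        ((integralClosure A E).algebraMap_mem e)) x.2)
    have hu' : algebraMap A (integralClosure A E) e * x = ⟨u, huD⟩ * ⟨u, huD⟩ := Subtype.ext hu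
    have hv' : (1 - algebraMap A (integralClosure A E) e) * x = -(⟨v, hvD⟩ * ⟨v, hvD⟩) :=
      Subtype.ext hv
    have hmem : algebraMap A (integralClosure A E) e * (1 - algebraMap A _ e) ∈ q := by
      rw [mul_sub, mul_one, ← map_mul, he, sub_self]
      exact q.zero_mem
    rcases hq.isPrime.mem_or_mem hmem with h | h
    · right
      refine ⟨Ideal.Quotient.mk q ⟨v, hvD⟩, ?_⟩
      rw [← map_mul, ← map_neg, Ideal.Quotient.eq]
      rw [show -x - (⟨v, hvD⟩ * ⟨v, hvD⟩ : integralClosure A E) =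
        algebraMap A (integralClosure A E) e * (-x) by linear_combination -hv']
      exact q.mul_mem_right _ h
    · left
      refine ⟨Ideal.Quotient.mk q ⟨u, huD⟩, ?_⟩
      rw [← map_mul, Ideal.Quotient.eq, ← hu',
        show x - algebraMap A (integralClosure A E) e * x =
          (1 - algebraMap A (integralClosure A E) e) * x by ring]
      exact q.mul_mem_right _ h
  · have hf0 : f ≠ 0 := by rintro rfl; simp at hf
    have hlc : f.leadingCoeff ≠ 0 := leadingCoeff_ne_zero.2 hf0
    have hmonic : (f * C f.leadingCoeff⁻¹).Monic := monic_mul_leadingCoeff_inv hf0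
    have hdeg : (f * C f.leadingCoeff⁻¹).natDegree = f.natDegree :=
      natDegree_mul_leadingCoeff_inv f hf0
    obtain ⟨g, hgf, hgdeg, hg⟩ := lifts_and_natDegree_eq_and_monic
      (f := Ideal.Quotient.mk q) (p := f * C f.leadingCoeff⁻¹) (by
        rw [lifts_iff_coeff_lifts]
        exact fun n => Ideal.Quotient.mk_surjective _) hmonic
    have hnt : Nontrivial E := by
      by_contra hcon
      rw [not_nontrivial_iff_subsingleton] at hcon
      have : Subsingleton (integralClosure A E) := Subtype.val_injective.subsingleton
      exact hq.ne_top (Subsingleton.elim _ _)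
    obtain ⟨r, hr⟩ := hE.exists_isRoot (g.map (algebraMap (integralClosure A E) E)) (hg.map _)
      (by rwa [hg.natDegree_map, hgdeg, hdeg])
    have hrD : r ∈ integralClosure A E :=
      isIntegral_trans (A := integralClosure A E) r
        ⟨g, hg, by rwa [IsRoot.def, eval_map] at hr⟩
    refine ⟨Ideal.Quotient.mk q ⟨r, hrD⟩, ?_⟩
    have hroot : g.eval ⟨r, hrD⟩ = 0 := by
      apply Subtype.val_injective
      rw [IsRoot.def, eval_map] at hr
      exact (eval₂_at_apply (algebraMap (integralClosure A E) E) ⟨r, hrD⟩).symm.trans hr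
    have h1 : (f * C f.leadingCoeff⁻¹).eval (Ideal.Quotient.mk q ⟨r, hrD⟩) = 0 := by
      rw [← hgf, eval_map, eval₂_at_apply, hroot, map_zero]
    rw [eval_mul, eval_C, mul_eq_zero] at h1
    exact h1.resolve_right (inv_ne_zero hlc)

theorem IsPointwiseRealClosed.isRealClosureStar_integralClosure [PartialOrder A]
    (hE : IsPointwiseRealClosed E) (hA : IsVonNeumannRegular A) (hbaer : IsBaerRing A)
    (hess : IsEssentialExtension A E) (hsq : ∀ a : A, 0 ≤ a → IsSquare (algebraMap A E a)) :
    IsRealClosureStar A (integralClosure A E) := by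
  have hE₁ := hE.isFormallyReal
  have hDreal : IsFormallyReal (integralClosure A E) :=
    hE₁.of_injective (integralClosure A E).val.toRingHom Subtype.val_injective
  have hess' := hess.integralClosure hA hbaer
  refine ⟨isRealClosedStar_of_isRealClosed_quotient hA hbaer hess' hDreal
    (fun q _ => hE.isRealClosed_quotient hA hbaer hess q), inferInstance, hess', ?_⟩
  -- The order is given by the elements that are squares in `E`; reality of `E` makes it
  -- antisymmetric.
  let P : RingCone (integralClosure A E) :=
    { carrier := {x | IsSquare (x : E)}
      mul_mem' := fun hx hy => IsSquare.mul hx hy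
      one_mem' := ⟨1, by simp⟩
      add_mem' := fun hx hy => hE.isSquare_add _ _ hx hy
      zero_mem' := ⟨0, by simp⟩
      eq_zero_of_mem_of_neg_mem' := fun {x} hx hy => Subtype.ext
        (IsFormallyReal.eq_zero_of_isSumSq_of_neg_isSumSq (IsSquare.isSumSq hx)
          (IsSquare.isSumSq hy)) }
  let _ : PartialOrder (integralClosure A E) := .mkOfAddGroupCone P
  have : IsOrderedRing (integralClosure A E) := .mkOfCone P
  have hnonneg : ∀ x : integralClosure A E, 0 ≤ x ↔ IsSquare (x : E) := by
    intro x
    change x - 0 ∈ P ↔ _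
    rw [sub_zero]
    rfl
  exact ⟨inferInstance, ⟨fun a => (hnonneg _).2 ⟨a, rfl⟩⟩, fun a ha => (hnonneg _).2 (hsq a ha)⟩

end IntegralClosure

/-! ### The real closed fields `ρ(α)`. -/

section Rho

variable {A : Type u} [CommRing A]

namespace PrimeCone

theorem mem_supp {α : PrimeCone A} {a : A} : a ∈ α.supp.asIdeal ↔ a ∈ α ∧ -a ∈ α := Iff.rfl

theorem mem_or_neg_mem (α : PrimeCone A) (a : A) : a ∈ α ∨ -a ∈ α :=
  HasMemOrNegMem.mem_or_neg_mem (S := RingPreordering A) (s := α.1) a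

theorem mem_comap {B : Type u} [CommRing B] {f : A →+* B} {β : PrimeCone B} {a : A} :
    a ∈ comap f β ↔ f a ∈ β := Iff.rfl

theorem mem_of_le_of_supp_eq {α β : PrimeCone A} (h : ∀ a ∈ α, a ∈ β) (hs : α.supp = β.supp) :
    α = β := by
  refine SetLike.ext fun a => ⟨h a, fun ha => ?_⟩
  rcases α.mem_or_neg_mem a with h' | h'
  · exact h'
  · have : a ∈ β.supp.asIdeal := ⟨ha, h _ h'⟩
    rw [← hs] at this
    exact this.1

/-- The prime cone of the squares of a real closed field. -/
def squares (R : Type u) [Field R] [IsRealClosed R] : PrimeCone R :=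
  ⟨RingPreordering.mk' {x : R | IsSquare x} (fun h h' => IsRealClosed.isSquare_add h h')
      (fun h h' => IsSquare.mul h h') (fun x => ⟨x, rfl⟩)
      (fun h => IsSemireal.not_isSumSq_neg_one R (IsSquare.isSumSq h)),
    RingPreordering.isOrdering_iff.2 fun a b h => by
      obtain ⟨_, _, hsq⟩ := IsRealClosed.exists_linearOrder (F := R)
      simp only [RingPreordering.mem_mk', Set.mem_ofPred_eq, ← hsq] at h ⊢
      by_contra! hcon
      exact (mul_pos_of_neg_of_neg hcon.1 hcon.2).not_ge (neg_nonneg.1 h)⟩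

theorem mem_supp_squares {R : Type u} [Field R] [IsRealClosed R] {x : R} :
    x ∈ (squares R).supp.asIdeal ↔ x = 0 := by
  rw [IsRealClosed.eq_zero_iff_isSquare_and_isSquare_neg]
  rfl

end PrimeCone

namespace IsRho

variable {α : PrimeCone A} {R : Type u} [Field R] [Algebra A R]

theorem algebraMap_eq_zero_iff (h : IsRho α R) {a : A} :
    algebraMap A R a = 0 ↔ a ∈ α.supp.asIdeal := by
  rw [← h.ker_eq, RingHom.mem_ker]

/-- If `a` is a square in `R` but `-a ∈ α`, then both signs are squares, so `a` lies in the support.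
Thus `R` determines `α`. -/
theorem mem_iff (h : IsRho α R) {a : A} : a ∈ α ↔ IsSquare (algebraMap A R a) := by
  refine ⟨h.isSquare a, fun ha => ?_⟩
  rcases α.mem_or_neg_mem a with h' | h'
  · exact h'
  · have := h.isRealClosed
    have h1 := h.isSquare _ h'
    rw [map_neg] at h1
    exact (h.algebraMap_eq_zero_iff.1
      ((IsRealClosed.eq_zero_iff_isSquare_and_isSquare_neg _).2 ⟨ha, h1⟩)).1

theorem comap_squares_eq (h : IsRho α R) :
    haveI := h.isRealClosed
    PrimeCone.comap (algebraMap A R) (PrimeCone.squares R) = α :=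
  haveI := h.isRealClosed
  SetLike.ext fun _ => h.mem_iff.symm

/-- The algebra structure of `ρ(α)` over the residue ring of the support. -/
noncomputable abbrev quotientAlgebra (h : IsRho α R) : Algebra (A ⧸ α.supp.asIdeal) R :=
  (Ideal.Quotient.lift α.supp.asIdeal (algebraMap A R)
    fun _ ha => h.algebraMap_eq_zero_iff.2 ha).toAlgebra

theorem isAlgebraic_quotient (h : IsRho α R) [α.supp.asIdeal.IsMaximal] :
    letI := Ideal.Quotient.field α.supp.asIdeal
    letI := h.quotientAlgebra
    Algebra.IsAlgebraic (A ⧸ α.supp.asIdeal) R := by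
  let _ := Ideal.Quotient.field α.supp.asIdeal
  let _ := h.quotientAlgebra
  have htower : IsScalarTower A (A ⧸ α.supp.asIdeal) R := .of_algebraMap_eq' rfl
  refine ⟨fun r => ?_⟩
  obtain ⟨f, hf, hr⟩ := h.algebraic r
  refine ⟨f.map (algebraMap A (A ⧸ α.supp.asIdeal)), fun h0 => hf ?_, ?_⟩
  · rw [IsScalarTower.algebraMap_eq A (A ⧸ α.supp.asIdeal) R, ← Polynomial.map_map, h0,
      Polynomial.map_zero]
  · rwa [aeval_map_algebraMap]

theorem isIntegral (h : IsRho α R) [α.supp.asIdeal.IsMaximal] : Algebra.IsIntegral A R := by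
  let _ := Ideal.Quotient.field α.supp.asIdeal
  let _ := h.quotientAlgebra
  have htower : IsScalarTower A (A ⧸ α.supp.asIdeal) R := .of_algebraMap_eq' rfl
  have := h.isAlgebraic_quotient
  exact .trans (A ⧸ α.supp.asIdeal)

theorem of_isIntegral (hR : IsRealClosed R) [Algebra.IsIntegral A R]
    (hker : ∀ a : A, algebraMap A R a = 0 ↔ a ∈ α.supp.asIdeal)
    (hsq : ∀ a ∈ α, IsSquare (algebraMap A R a)) : IsRho α R where
  isRealClosed := hR
  ker_eq := Ideal.ext fun a => hker a
  algebraic r := by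
    obtain ⟨f, hf, hr⟩ := Algebra.IsIntegral.isIntegral (R := A) r
    exact ⟨f, (hf.map _).ne_zero, hr⟩
  isSquare := hsq

theorem nonempty_algEquiv [α.supp.asIdeal.IsMaximal] {R' : Type u} [Field R'] [Algebra A R']
    (h : IsRho α R) (h' : IsRho α R') : Nonempty (R ≃ₐ[A] R') := by
  let _ := Ideal.Quotient.field α.supp.asIdeal
  let _ := h.quotientAlgebra
  let _ := h'.quotientAlgebra
  have : IsScalarTower A (A ⧸ α.supp.asIdeal) R := .of_algebraMap_eq' rfl
  have : IsScalarTower A (A ⧸ α.supp.asIdeal) R' := .of_algebraMap_eq' rfl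
  have := h.isAlgebraic_quotient
  have := h'.isAlgebraic_quotient
  have := h.isRealClosed
  have := h'.isRealClosed
  obtain ⟨e⟩ := IsRealClosed.nonempty_algEquiv (K := A ⧸ α.supp.asIdeal) (L := R) (R := R')
    (fun k => by
      obtain ⟨a, rfl⟩ := Ideal.Quotient.mk_surjective k
      exact h.mem_iff.symm.trans h'.mem_iff)
  exact ⟨e.restrictScalars A⟩

/-- The fields `ρ(α)` exist for the prime cones with maximal support. -/
theorem exists_isRho (α : PrimeCone A) [hα : α.supp.asIdeal.IsMaximal] :
    ∃ (R : Type u) (_ : Field R) (_ : Algebra A R), IsRho α R := by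
  let _ := Ideal.Quotient.field α.supp.asIdeal
  let P : RingPreordering (A ⧸ α.supp.asIdeal) := RingPreordering.mk'
    {x | ∃ a ∈ α, Ideal.Quotient.mk _ a = x}
    (by
      rintro _ _ ⟨a, ha, rfl⟩ ⟨b, hb, rfl⟩
      exact ⟨a + b, add_mem (S := RingPreordering A) (s := α.1) ha hb, map_add _ _ _⟩)
    (by
      rintro _ _ ⟨a, ha, rfl⟩ ⟨b, hb, rfl⟩
      exact ⟨a * b, mul_mem (S := RingPreordering A) (s := α.1) ha hb, map_mul _ _ _⟩)
    (fun x => by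
      obtain ⟨a, rfl⟩ := Ideal.Quotient.mk_surjective x
      exact ⟨a * a, α.1.mul_self_mem a, map_mul _ _ _⟩)
    (by
      rintro ⟨a, ha, h⟩
      have h1 : a + 1 ∈ α.supp.asIdeal := by
        rw [← Ideal.Quotient.eq_zero_iff_mem, map_add, h, map_one, neg_add_cancel]
      refine α.1.neg_one_notMem ?_
      have h2 : -(a + 1) + a ∈ α.1 := add_mem h1.2 ha
      rwa [show -(a + 1) + a = -1 by ring] at h2)
  obtain ⟨R, _, _, hR, halg, hsq⟩ := exists_realClosure P
  let _ : Algebra A R := ((algebraMap (A ⧸ α.supp.asIdeal) R).comp (Ideal.Quotient.mk _)).toAlgebra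
  have : IsScalarTower A (A ⧸ α.supp.asIdeal) R := .of_algebraMap_eq' rfl
  have : Algebra.IsIntegral A R := .trans (A ⧸ α.supp.asIdeal)
  refine ⟨R, inferInstance, inferInstance, .of_isIntegral hR (fun a => ?_) fun a ha => ?_⟩
  · rw [IsScalarTower.algebraMap_apply A (A ⧸ α.supp.asIdeal) R, map_eq_zero]
    exact Ideal.Quotient.eq_zero_iff_mem
  · exact hsq _ ⟨a, ha, rfl⟩

end IsRho

end Rho

/-! ### The ideal `J` and the choice of `I`. -/

section EssentialQuotient

variable {A B : Type u} [CommRing A] [CommRing B] [Algebra A B]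

/-- Pulling back the squares along the evaluation at `i` gives a prime cone over `α i` whose support
is the kernel of that evaluation; these kernels intersect in zero. -/
theorem vanishingIdealOver_eq_bot {ι : Type u} {R : ι → Type u} [∀ i, Field (R i)]
    [∀ i, Algebra A (R i)] {α : ι → PrimeCone A} (hR : ∀ i, IsRho (α i) (R i)) :
    vanishingIdealOver (∀ i, R i) (Set.range α) = ⊥ := by
  rw [Submodule.eq_bot_iff]
  intro x hx
  funext i
  have := (hR i).isRealClosed
  simp only [vanishingIdealOver, Submodule.mem_iInf] at hx
  exact PrimeCone.mem_supp_squares.1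
    (hx (PrimeCone.comap (Pi.evalRingHom R i) (PrimeCone.squares (R i)))
      ⟨i, (hR i).comap_squares_eq.symm⟩)

/-- An ideal maximal among those meeting `A` trivially has an essential quotient. -/
theorem exists_isEssentialExtension_quotient (h : Function.Injective (algebraMap A B)) :
    ∃ I : Ideal B, IsEssentialExtension A (B ⧸ I) := by
  obtain ⟨I, -, hI, hmax⟩ := zorn_le_nonempty₀ {I : Ideal B | I.comap (algebraMap A B) = ⊥}
    (fun c hc hchain I₀ hI₀ => by
      refine ⟨sSup c, ?_, fun I hI => le_sSup hI⟩
      rw [Set.mem_ofPred_eq, Submodule.eq_bot_iff]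
      intro a ha
      obtain ⟨I, hI, haI⟩ :=
        (Submodule.mem_sSup_of_directed ⟨I₀, hI₀⟩ hchain.directedOn).1 (Ideal.mem_comap.1 ha)
      have := hc hI
      exact (Submodule.eq_bot_iff _).1 this a haI) ⊥
    (by
      rw [Set.mem_ofPred_eq, ← RingHom.ker_eq_comap_bot]
      exact (RingHom.injective_iff_ker_eq_bot _).1 h)
  have hcomp : algebraMap A (B ⧸ I) = (Ideal.Quotient.mk I).comp (algebraMap A B) := rfl
  refine ⟨I, ?_, fun J hJ hbot => hJ ?_⟩
  · rw [RingHom.injective_iff_ker_eq_bot, hcomp, ← RingHom.comap_ker, Ideal.mk_ker]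
    exact hI
  · rw [hcomp, ← Ideal.comap_comap] at hbot
    have hle : I ≤ J.comap (Ideal.Quotient.mk I) := by
      intro x hx
      rw [Ideal.mem_comap, Ideal.Quotient.eq_zero_iff_mem.2 hx]
      exact J.zero_mem
    have hle' := hmax hbot hle
    rw [Submodule.eq_bot_iff]
    intro x hx
    obtain ⟨x, rfl⟩ := Ideal.Quotient.mk_surjective x
    exact Ideal.Quotient.eq_zero_iff_mem.2 (hle' hx)

end EssentialQuotient

/-! ### Maximal cones and their localizations. -/

section MaximalCone

variable {A C : Type u} [CommRing A] [CommRing C] [Algebra A C]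

theorem RingCone.exists_maximal (T₀ : RingCone C) : ∃ T, T₀ ≤ T ∧ Maximal (T₀ ≤ ·) T := by
  obtain ⟨T, hT₀, hT⟩ := zorn_le_nonempty₀ {T : RingCone C | T₀ ≤ T} (fun c hc hchain y hy => by
    refine ⟨{ carrier := {z | ∃ T ∈ c, z ∈ T}
              mul_mem' := ?_
              one_mem' := ⟨y, hy, one_mem y⟩
              add_mem' := ?_
              zero_mem' := ⟨y, hy, zero_mem y⟩
              eq_zero_of_mem_of_neg_mem' := ?_ }, ?_, ?_⟩
    · rintro a b ⟨S, hS, ha⟩ ⟨S', hS', hb⟩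
      rcases hchain.total hS hS' with h | h
      · exact ⟨S', hS', mul_mem (h ha) hb⟩
      · exact ⟨S, hS, mul_mem ha (h hb)⟩
    · rintro a b ⟨S, hS, ha⟩ ⟨S', hS', hb⟩
      rcases hchain.total hS hS' with h | h
      · exact ⟨S', hS', add_mem (h ha) hb⟩
      · exact ⟨S, hS, add_mem ha (h hb)⟩
    · rintro a ⟨S, hS, ha⟩ ⟨S', hS', hb⟩
      rcases hchain.total hS hS' with h | h
      · exact eq_zero_of_mem_of_neg_mem (h ha) hb
      · exact eq_zero_of_mem_of_neg_mem ha (h hb)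
    · exact fun a ha => ⟨y, hy, hc hy ha⟩
    · exact fun S hS a ha => ⟨S, hS, ha⟩) T₀ (show T₀ ≤ T₀ from le_rfl)
  exact ⟨T, hT₀, hT⟩

/-- The set of idempotents that carry `x` into `T` has trivial annihilator. -/
def IsDenselyIn (A : Type u) {C : Type u} [CommRing A] [CommRing C] [Algebra A C]
    (T : RingCone C) (x : C) : Prop :=
  ∀ a : A, (∀ e : A, IsIdempotentElem e → algebraMap A C e * x ∈ T → a * e = 0) → a = 0

variable {T₀ T : RingCone C}

theorem RingCone.algebraMap_mem_of_isIdempotentElem (hsq : ∀ x : C, x * x ∈ T) {e : A}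
    (he : IsIdempotentElem e) : algebraMap A C e ∈ T := by
  have := hsq (algebraMap A C e)
  rwa [← map_mul, he] at this

/-- The elements densely in `T` form a cone containing `T`, so maximality gives equality.
Antisymmetry uses essentiality: if `e * y` and `-(f * y)` lie in `T`, then `e * f` kills `y`, and
hence every multiple of `y` in `A`. -/
theorem mem_of_isDenselyIn (hess : IsEssentialExtension A C) (hsq : ∀ x : C, x * x ∈ T)
    (hT : Maximal (T₀ ≤ ·) T) {x : C} (hx : IsDenselyIn A T x) : x ∈ T := by
  have hidem : ∀ {e : A}, IsIdempotentElem e → algebraMap A C e ∈ T :=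
    RingCone.algebraMap_mem_of_isIdempotentElem hsq
  have hself : ∀ {y : C}, y ∈ T → IsDenselyIn A T y := fun hy a ha => by
    simpa using ha 1 .one (by simpa using hy)
  have hpair : ∀ {y z : C}, IsDenselyIn A T y → IsDenselyIn A T z → ∀ a : A,
      (∀ e f : A, IsIdempotentElem e → IsIdempotentElem f → algebraMap A C e * y ∈ T →
        algebraMap A C f * z ∈ T → a * (e * f) = 0) → a = 0 := by
    intro y z hy hz a h
    refine hy a fun e he hey => hz _ fun f hf hfz => ?_
    rw [mul_assoc]
    exact h e f he hf hey hfz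
  let T' : RingCone C :=
    { carrier := {y | IsDenselyIn A T y}
      mul_mem' := fun {y z} hy hz a ha => hpair hy hz a fun e f he hf hey hfz => by
        refine ha _ (he.mul hf) ?_
        rw [map_mul, mul_mul_mul_comm]
        exact mul_mem hey hfz
      one_mem' := hself (one_mem T)
      add_mem' := fun {y z} hy hz a ha => hpair hy hz a fun e f he hf hey hfz => by
        refine ha _ (he.mul hf) ?_
        rw [map_mul, show algebraMap A C e * algebraMap A C f * (y + z) =
          algebraMap A C f * (algebraMap A C e * y) +
          algebraMap A C e * (algebraMap A C f * z) by ring]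
        exact add_mem (mul_mem (hidem hf) hey) (mul_mem (hidem he) hfz)
      zero_mem' := hself (zero_mem T)
      eq_zero_of_mem_of_neg_mem' := fun {y} hy hy' => hess.eq_zero_of_forall fun a z haz =>
        hpair hy hy' a fun e f he hf hey hfy => by
          have h1 : algebraMap A C (e * f) * y = 0 := by
            refine eq_zero_of_mem_of_neg_mem (S := RingCone C) (C := T) ?_ ?_
            · rw [map_mul, mul_right_comm, mul_comm]
              exact mul_mem (hidem hf) hey
            · rw [map_mul, mul_assoc, ← mul_neg, ← mul_neg]
              exact mul_mem (hidem he) hfy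
          apply hess.1
          rw [map_mul, haz, map_zero]
          linear_combination z * h1 }
  have hTT' : T ≤ T' := fun y hy => hself hy
  exact hT.2 (hT.1.trans hTT') hTT' hx

/-- The idempotents on which `x` has a definite sign have trivial annihilator. If an idempotent `f`
kills them all, then `T + f * x * T` is still a cone, so `f * x ∈ T` by maximality; then `f` is one
of them and `f = f * f = 0`. -/
theorem eq_zero_of_forall_isIdempotentElem (hA : IsVonNeumannRegular A) (hC : IsVonNeumannRegular C)
    (hbaer : IsBaerRing A) (hess : IsEssentialExtension A C) (hsq : ∀ x : C, x * x ∈ T)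
    (hT : Maximal (T₀ ≤ ·) T) (x : C) (a : A)
    (ha : ∀ e : A, IsIdempotentElem e →
      (algebraMap A C e * x ∈ T ∨ -(algebraMap A C e * x) ∈ T) → a * e = 0) : a = 0 := by
  have hidem : ∀ {e : A}, IsIdempotentElem e → algebraMap A C e ∈ T :=
    RingCone.algebraMap_mem_of_isIdempotentElem hsq
  obtain ⟨f, b, hf, hab, haf⟩ := hA.exists_idempotent a
  suffices hf0 : f = 0 by rw [← haf, hf0, mul_zero]
  replace ha : ∀ e : A, IsIdempotentElem e →
      (algebraMap A C e * x ∈ T ∨ -(algebraMap A C e * x) ∈ T) → f * e = 0 := by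
    intro e he h
    rw [← hab]
    linear_combination b * ha e he h
  set φ := algebraMap A C f with hφ
  -- A relation `t + φ * x * v = 0` makes `x` negative on the idempotent generated by `φ * v`, which
  -- `f` therefore kills.
  have hkey : ∀ {t v : C}, t ∈ T → v ∈ T → t + φ * x * v = 0 → φ * v = 0 := by
    intro t v ht hv h
    obtain ⟨γ, w, hγ, hw, hvγ⟩ := hC.exists_idempotent (φ * v)
    obtain ⟨g, hg, rfl⟩ := hbaer.exists_algebraMap_eq hess hγ
    have hγγ : algebraMap A C g * algebraMap A C g = algebraMap A C g := hγ
    have hneg : -(algebraMap A C g * x) = t * (w * w) * (φ * v) := by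
      rw [← hγγ, ← hw]
      linear_combination (-φ * v * w * w) * h
    have hg0 : f * g = 0 := ha g hg (.inr (by
      rw [hneg]
      exact mul_mem (mul_mem ht (hsq w)) (mul_mem (hidem hf) hv)))
    have hg0' : φ * algebraMap A C g = 0 := by rw [hφ, ← map_mul, hg0, map_zero]
    rw [← hvγ]
    linear_combination v * hg0'
  let T' : RingCone C :=
    { carrier := {y | ∃ t ∈ T, ∃ v ∈ T, y = t + φ * x * v}
      mul_mem' := by
        rintro _ _ ⟨t, ht, v, hv, rfl⟩ ⟨t', ht', v', hv', rfl⟩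
        exact ⟨t * t' + (φ * x) * (φ * x) * (v * v'),
          add_mem (mul_mem ht ht') (mul_mem (hsq _) (mul_mem hv hv')),
          t * v' + t' * v, add_mem (mul_mem ht hv') (mul_mem ht' hv), by ring⟩
      one_mem' := ⟨1, one_mem T, 0, zero_mem T, by ring⟩
      add_mem' := by
        rintro _ _ ⟨t, ht, v, hv, rfl⟩ ⟨t', ht', v', hv', rfl⟩
        exact ⟨t + t', add_mem ht ht', v + v', add_mem hv hv', by ring⟩
      zero_mem' := ⟨0, zero_mem T, 0, zero_mem T, by ring⟩
      eq_zero_of_mem_of_neg_mem' := by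
        rintro _ ⟨t, ht, v, hv, rfl⟩ ⟨t', ht', v', hv', h⟩
        have h0 : (t + t') + φ * x * (v + v') = 0 := by linear_combination -h
        have h1 := hkey (add_mem ht ht') (add_mem hv hv') h0
        have h2 : t = 0 := eq_zero_of_mem_of_neg_mem ht (by
          rwa [show -t = t' by linear_combination -h0 + x * h1])
        have h3 : φ * v = 0 := eq_zero_of_mem_of_neg_mem (mul_mem (hidem hf) hv) (by
          rw [show -(φ * v) = φ * v' by linear_combination -h1]
          exact mul_mem (hidem hf) hv')
        rw [h2]
        linear_combination x * h3 }
  have hTT' : T ≤ T' := fun y hy => ⟨y, hy, 0, zero_mem T, by ring⟩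
  have hmem : φ * x ∈ T := hT.2 (hT.1.trans hTT') hTT' ⟨0, zero_mem T, 1, one_mem T, by ring⟩
  rw [← hf]
  exact ha f hf (.inl hmem)

/-- A maximal cone of an essential extension of a Baer ring is total up to idempotents. -/
theorem RingCone.exists_isIdempotentElem_of_maximal (hA : IsVonNeumannRegular A)
    (hC : IsVonNeumannRegular C) (hbaer : IsBaerRing A) (hess : IsEssentialExtension A C)
    (hsq : ∀ x : C, x * x ∈ T) (hT : Maximal (T₀ ≤ ·) T) (x : C) :
    ∃ e : A, IsIdempotentElem e ∧ algebraMap A C e * x ∈ T ∧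
      -(algebraMap A C (1 - e) * x) ∈ T := by
  have hidem : ∀ {e : A}, IsIdempotentElem e → algebraMap A C e ∈ T :=
    RingCone.algebraMap_mem_of_isIdempotentElem hsq
  -- The Baer property supplies `1 - u`, the supremum of the idempotents on which `x` is
  -- nonnegative. Density of `T` then gives `(1 - u) * x ∈ T` and `-(u * x) ∈ T`.
  obtain ⟨u, hu, hann⟩ := hbaer {e | IsIdempotentElem e ∧ algebraMap A C e * x ∈ T}
  have hu' : u * u = u := hu
  have hmem : ∀ a : A, (∀ e : A, IsIdempotentElem e → algebraMap A C e * x ∈ T → a * e = 0) ↔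
      a * u = a := by
    intro a
    rw [show a * u = a ↔ a ∈ (Ideal.span {u} : Set A) from ?_, ← hann]
    · exact ⟨fun h e he => h e he.1 he.2, fun h e he he' => h e ⟨he, he'⟩⟩
    · rw [SetLike.mem_coe, Ideal.mem_span_singleton']
      exact ⟨fun h => ⟨a, h⟩, by rintro ⟨y, rfl⟩; rw [mul_assoc, hu]⟩
  refine ⟨1 - u, hu.one_sub, ?_, ?_⟩
  · refine mem_of_isDenselyIn hess hsq hT fun a ha => ?_
    have h1 : a * u = a := (hmem a).1 fun e he hex => ha e he (by
      rw [mul_left_comm]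
      exact mul_mem (hidem hu.one_sub) hex)
    rw [← h1]
    refine ha u hu ?_
    rw [← mul_assoc, ← map_mul, mul_sub, hu', mul_one, sub_self, map_zero, zero_mul]
    exact zero_mem T
  · rw [sub_sub_cancel]
    refine mem_of_isDenselyIn hess hsq hT fun a ha => ?_
    have h1 : a * (1 - u) = 0 := ha _ hu.one_sub (by
      rw [mul_neg, ← mul_assoc, ← map_mul, sub_mul, hu', one_mul, sub_self, map_zero, zero_mul,
        neg_zero]
      exact zero_mem T)
    have h2 : a * u = a := by linear_combination -h1
    refine eq_zero_of_forall_isIdempotentElem hA hC hbaer hess hsq hT x a fun e he h => ?_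
    rcases h with h | h
    · exact (hmem a).2 h2 e he h
    · refine ha e he ?_
      rw [mul_neg, mul_left_comm, ← mul_neg]
      exact mul_mem (hidem hu) h

/-- The localizations of a cone that is total up to idempotents are prime cones. -/
theorem RingCone.exists_primeCone (hC : IsVonNeumannRegular C) (hbaer : IsBaerRing A)
    (hess : IsEssentialExtension A C) (hsq : ∀ x : C, x * x ∈ T)
    (htot : ∀ x : C, ∃ e : A, IsIdempotentElem e ∧ algebraMap A C e * x ∈ T ∧
      -(algebraMap A C (1 - e) * x) ∈ T) (q : PrimeSpectrum C) :
    ∃ t : PrimeCone C, t.supp = q ∧ ∀ x, x ∈ t ↔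
      ∃ e : A, IsIdempotentElem e ∧ algebraMap A C e ∉ q.asIdeal ∧ algebraMap A C e * x ∈ T := by
  have hidem : ∀ {e : A}, IsIdempotentElem e → algebraMap A C e ∈ T :=
    RingCone.algebraMap_mem_of_isIdempotentElem hsq
  have hprod : ∀ {e f : A}, algebraMap A C e ∉ q.asIdeal → algebraMap A C f ∉ q.asIdeal →
      algebraMap A C (e * f) ∉ q.asIdeal := by
    intro e f he hf h
    rw [map_mul] at h
    exact (q.2.mem_or_mem h).elim he hf
  have hone : algebraMap A C 1 ∉ q.asIdeal := by
    rw [map_one]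
    exact (Ideal.ne_top_iff_one _).1 q.2.ne_top
  have hzero : ∀ {x : C}, x ∈ q.asIdeal → ∃ e : A, IsIdempotentElem e ∧
      algebraMap A C e ∉ q.asIdeal ∧ algebraMap A C e * x = 0 := by
    intro x hx
    obtain ⟨ε, hε, hεq, h⟩ := hC.exists_idempotent_of_mem hx
    obtain ⟨e, he, rfl⟩ := hbaer.exists_algebraMap_eq hess hε
    exact ⟨e, he, hεq, h⟩
  have hmemq : ∀ {e : A} {x : C}, algebraMap A C e ∉ q.asIdeal → algebraMap A C e * x = 0 →
      x ∈ q.asIdeal := fun he h =>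
    (q.2.mem_or_mem (h ▸ q.asIdeal.zero_mem)).resolve_left he
  let P : RingPreordering C := RingPreordering.mk'
    {x | ∃ e : A, IsIdempotentElem e ∧ algebraMap A C e ∉ q.asIdeal ∧ algebraMap A C e * x ∈ T}
    (by
      rintro x y ⟨e, he, heq, hx⟩ ⟨f, hf, hfq, hy⟩
      refine ⟨e * f, he.mul hf, hprod heq hfq, ?_⟩
      rw [map_mul, show algebraMap A C e * algebraMap A C f * (x + y) =
          algebraMap A C f * (algebraMap A C e * x) +
          algebraMap A C e * (algebraMap A C f * y) by ring]
      exact add_mem (mul_mem (hidem hf) hx) (mul_mem (hidem he) hy))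
    (by
      rintro x y ⟨e, he, heq, hx⟩ ⟨f, hf, hfq, hy⟩
      refine ⟨e * f, he.mul hf, hprod heq hfq, ?_⟩
      rw [map_mul, mul_mul_mul_comm]
      exact mul_mem hx hy)
    (fun x => ⟨1, .one, hone, by simpa using hsq x⟩)
    (by
      rintro ⟨e, he, heq, h⟩
      apply heq
      rw [mul_neg, mul_one] at h
      rw [eq_zero_of_mem_of_neg_mem (hidem he) h]
      exact q.asIdeal.zero_mem)
  have hP : P.IsOrdering := by
    refine RingPreordering.isOrdering_iff.2 fun a b h => ?_
    obtain ⟨g, hg, hgq, hab⟩ := h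
    obtain ⟨e, he, he1, he2⟩ := htot a
    obtain ⟨f, hf, hf1, hf2⟩ := htot b
    by_cases heq : algebraMap A C e ∈ q.asIdeal
    swap
    · exact .inl ⟨e, he, heq, he1⟩
    by_cases hfq : algebraMap A C f ∈ q.asIdeal
    swap
    · exact .inr ⟨f, hf, hfq, hf1⟩
    have hcompl : ∀ {e : A}, algebraMap A C e ∈ q.asIdeal → algebraMap A C (1 - e) ∉ q.asIdeal := by
      intro e he h
      rw [map_sub] at h
      exact hone ((Submodule.sub_mem_iff_left _ he).1 h)
    -- Where `a` and `b` are both nonpositive their product is nonnegative, yet `-(a * b)` is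
    -- nonnegative on `g`; the product vanishes there.
    have h0 : algebraMap A C ((1 - e) * (1 - f) * g) * (a * b) = 0 := by
      refine eq_zero_of_mem_of_neg_mem (S := RingCone C) (C := T) ?_ ?_
      · have := mul_mem (hidem hg) (mul_mem he2 hf2)
        rw [map_mul, map_mul]
        convert this using 1
        ring
      · have := mul_mem (hidem (he.one_sub.mul hf.one_sub)) hab
        rw [map_mul]
        convert this using 1
        ring
    have hab0 := hmemq (hprod (hprod (hcompl heq) (hcompl hfq)) hgq) h0
    rcases q.2.mem_or_mem hab0 with h | h
    · obtain ⟨e, he, heq, h⟩ := hzero h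
      exact .inl ⟨e, he, heq, h ▸ zero_mem T⟩
    · obtain ⟨e, he, heq, h⟩ := hzero h
      exact .inr ⟨e, he, heq, h ▸ zero_mem T⟩
  refine ⟨⟨P, hP⟩, PrimeSpectrum.ext (Ideal.ext fun x => ⟨?_, fun hx => ?_⟩), fun x => Iff.rfl⟩
  · rintro ⟨⟨e, he, heq, hx⟩, ⟨f, hf, hfq, hy⟩⟩
    refine hmemq (hprod heq hfq) (eq_zero_of_mem_of_neg_mem (S := RingCone C) (C := T) ?_ ?_)
    · rw [map_mul, mul_right_comm, mul_comm]
      exact mul_mem (hidem hf) hx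
    · rw [map_mul, mul_assoc, ← mul_neg, ← mul_neg]
      exact mul_mem (hidem he) hy
  · obtain ⟨e, he, heq, h⟩ := hzero hx
    exact ⟨⟨e, he, heq, h ▸ zero_mem T⟩, ⟨e, he, heq, by
      rw [mul_neg, h, neg_zero]
      exact zero_mem T⟩⟩

end MaximalCone

/-! ### From a continuous section to a real closure `*`. -/

section Sections

variable {A : Type u} [CommRing A] [PartialOrder A]

theorem SuppSection.mem_supp_iff (s : SuppSection A) {p : PrimeSpectrum A} {a : A} :
    a ∈ (s.1 p).1.supp.asIdeal ↔ a ∈ p.asIdeal := by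
  rw [s.2.2 p]

theorem SuppSection.isMaximal_supp (hA : IsVonNeumannRegular A) (s : SuppSection A)
    (p : PrimeSpectrum A) : (s.1 p).1.supp.asIdeal.IsMaximal := by
  rw [s.2.2 p]
  exact hA.isMaximal _

/-- Positivity at one prime spreads to a clopen neighbourhood: by continuity if `a ∉ p`, and because
some idempotent outside `p` kills `a` if `a ∈ p`. This is where continuity of the section enters. -/
theorem SuppSection.exists_isIdempotentElem (hA : IsVonNeumannRegular A) (s : SuppSection A)
    {p : PrimeSpectrum A} {a : A} (ha : a ∈ (s.1 p).1) :
    ∃ e : A, IsIdempotentElem e ∧ e ∉ p.asIdeal ∧ ∀ p', e * a ∈ (s.1 p').1 := by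
  by_cases hap : a ∈ p.asIdeal
  · obtain ⟨e, he, hep, h⟩ := hA.exists_idempotent_of_mem hap
    exact ⟨e, he, hep, fun p' => by
      rw [h]
      exact zero_mem (s.1 p').1.1⟩
  · let U : Set (PrimeCone A) := {α | a ∈ α ∧ a ∉ α.supp.asIdeal}
    have hU : IsOpen U := TopologicalSpace.isOpen_generateFrom_of_mem ⟨a, rfl⟩
    have hopen : IsOpen ((fun p => (s.1 p).1) ⁻¹' U) :=
      hU.preimage (continuous_subtype_val.comp s.2.1)
    have hpU : p ∈ (fun p => (s.1 p).1) ⁻¹' U := ⟨ha, by rwa [s.mem_supp_iff]⟩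
    obtain ⟨_, ⟨f, rfl⟩, hpf, hfU⟩ :=
      PrimeSpectrum.isTopologicalBasis_basic_opens.exists_subset_of_mem_open hpU hopen
    obtain ⟨e, b, he, hfb, hfe⟩ := hA.exists_idempotent f
    refine ⟨e, he, fun h => hpf ?_, fun p' => ?_⟩
    · rw [← hfe]
      exact p.asIdeal.mul_mem_left _ h
    · by_cases hfp' : f ∈ p'.asIdeal
      · have h1 : e * a ∈ (s.1 p').1.supp.asIdeal := by
          rw [s.mem_supp_iff, ← hfb, mul_assoc]
          exact p'.asIdeal.mul_mem_right _ hfp'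
        exact h1.1
      · have h1 : a ∈ (s.1 p').1 := (hfU hfp').1
        have h2 : e ∈ (s.1 p').1 := by
          rw [← he]
          exact (s.1 p').1.1.mul_self_mem e
        exact mul_mem (S := RingPreordering A) (s := (s.1 p').1.1) h2 h1

variable {R : PrimeSpectrum A → Type u} [∀ p, Field (R p)] [∀ p, Algebra A (R p)]

theorem SuppSection.isSquare_algebraMap (s : SuppSection A) (hR : ∀ p, IsRho (s.1 p).1 (R p))
    (I : Ideal (∀ p, R p)) {a : A} (ha : ∀ p, a ∈ (s.1 p).1) :
    IsSquare (algebraMap A ((∀ p, R p) ⧸ I) a) :=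
  IsSquare.map (Ideal.Quotient.mk I)
    (Pi.isSquare_of_forall (x := algebraMap A (∀ p, R p) a) fun p => (hR p).isSquare a (ha p))

theorem SuppSection.injective_algebraMap (s : SuppSection A)
    (hR : ∀ p, IsRho (s.1 p).1 (R p)) [IsReduced A] :
    Function.Injective (algebraMap A (∀ p, R p)) := by
  rw [injective_iff_map_eq_zero]
  intro a ha
  refine IsNilpotent.eq_zero (nilpotent_iff_mem_prime.2 fun J hJ => ?_)
  have := congrFun ha ⟨J, hJ⟩
  exact s.mem_supp_iff.1 ((hR ⟨J, hJ⟩).algebraMap_eq_zero_iff.1 this)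

theorem SuppSection.isRealClosureStar_integralClosure (hA : IsVonNeumannRegular A)
    (hbaer : IsBaerRing A) (s : SuppSection A) (hR : ∀ p, IsRho (s.1 p).1 (R p))
    (I : Ideal (∀ p, R p)) (hI : IsEssentialExtension A ((∀ p, R p) ⧸ I)) :
    IsRealClosureStar A (integralClosure A ((∀ p, R p) ⧸ I)) := by
  have := fun p => (hR p).isRealClosed
  exact (IsPointwiseRealClosed.pi_quotient I).isRealClosureStar_integralClosure hA hbaer hI
    fun a ha => s.isSquare_algebraMap hR I fun p => (s.1 p).2 a ha

/-- The right-hand side depends only on the `A`-algebra, so isomorphic closures come from the same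
section. -/
theorem SuppSection.mem_iff (hA : IsVonNeumannRegular A)
    (hbaer : IsBaerRing A) (s : SuppSection A) (hR : ∀ p, IsRho (s.1 p).1 (R p))
    (I : Ideal (∀ p, R p)) (hI : IsEssentialExtension A ((∀ p, R p) ⧸ I))
    {p : PrimeSpectrum A} {a : A} : a ∈ (s.1 p).1 ↔
    ∃ e : A, IsIdempotentElem e ∧ e ∉ p.asIdeal ∧
      IsSquare (algebraMap A (integralClosure A ((∀ p, R p) ⧸ I)) (e * a)) := by
  have hD := s.isRealClosureStar_integralClosure hA hbaer hR I hI
  have key : ∀ {a : A}, a ∈ (s.1 p).1 → ∃ e : A, IsIdempotentElem e ∧ e ∉ p.asIdeal ∧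
      IsSquare (algebraMap A (integralClosure A ((∀ p, R p) ⧸ I)) (e * a)) := by
    intro a ha
    obtain ⟨e, he, hep, h⟩ := s.exists_isIdempotentElem hA ha
    obtain ⟨u, hu⟩ := s.isSquare_algebraMap hR I h
    have huD : u ∈ integralClosure A ((∀ p, R p) ⧸ I) :=
      IsIntegral.of_pow two_pos (by rw [sq, ← hu]; exact isIntegral_algebraMap)
    exact ⟨e, he, hep, ⟨u, huD⟩, Subtype.ext hu⟩
  refine ⟨key, fun ⟨e, he, hep, h⟩ => ?_⟩
  rcases (s.1 p).1.mem_or_neg_mem a with ha | ha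
  · exact ha
  obtain ⟨f, hf, hfp, h'⟩ := key ha
  have hreal := hD.1.1
  set ι := algebraMap A (integralClosure A ((∀ p, R p) ⧸ I)) with hι
  have hsq : ∀ {e : A}, IsIdempotentElem e → IsSquare (ι e) := fun {e} he =>
    ⟨ι e, by rw [← map_mul, he]⟩
  -- If `-a` were in the cone, then on `e * f` both `a` and `-a` would be squares, so `a` vanishes
  -- there and lies in `p`.
  have h0 : ι (f * (e * a)) = 0 := by
    refine IsFormallyReal.eq_zero_of_isSumSq_of_neg_isSumSq ?_ ?_
    · rw [map_mul]
      exact ((hsq hf).mul h).isSumSq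
    · rw [← map_neg, show -(f * (e * a)) = e * (f * -a) by ring, map_mul]
      exact ((hsq he).mul h').isSumSq
  have h1 : f * (e * a) = 0 := hD.2.2.1.1 (by rw [← hι, h0, map_zero])
  have h2 : f * (e * a) ∈ p.asIdeal := h1 ▸ p.asIdeal.zero_mem
  have h3 : a ∈ p.asIdeal :=
    (p.2.mem_or_mem ((p.2.mem_or_mem h2).resolve_left hfp)).resolve_left hep
  exact (s.mem_supp_iff.2 h3).1

/-- The residue field at a prime above `p` is itself a model of `ρ(s(p))`, and such models are
unique up to `A`-isomorphism. -/
theorem SuppSection.nonempty_algHom (hA : IsVonNeumannRegular A)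
    (hbaer : IsBaerRing A) (s : SuppSection A) (hR : ∀ p, IsRho (s.1 p).1 (R p))
    (I : Ideal (∀ p, R p)) (hI : IsEssentialExtension A ((∀ p, R p) ⧸ I))
    {R' : Type u} [Field R'] [Algebra A R'] {p : PrimeSpectrum A}
    (hR' : IsRho (s.1 p).1 R') :
    Nonempty (integralClosure A ((∀ p, R p) ⧸ I) →ₐ[A] R') := by
  have := fun p => (hR p).isRealClosed
  have hD := s.isRealClosureStar_integralClosure hA hbaer hR I hI
  have := hA.isMaximal p.asIdeal
  have := s.isMaximal_supp hA p
  obtain ⟨q, hq, hqp⟩ := Ideal.exists_ideal_over_maximal_of_isIntegral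
    (S := integralClosure A ((∀ p, R p) ⧸ I)) p.asIdeal
    (by rw [(RingHom.injective_iff_ker_eq_bot _).1 hD.2.2.1.1]; exact bot_le)
  let _ : Field (integralClosure A ((∀ p, R p) ⧸ I) ⧸ q) := Ideal.Quotient.field q
  have hmem : ∀ a : A, algebraMap A (integralClosure A ((∀ p, R p) ⧸ I)) a ∈ q ↔
      a ∈ p.asIdeal := fun a => by rw [← hqp, Ideal.mem_comap]
  have hintegral : Algebra.IsIntegral A (integralClosure A ((∀ p, R p) ⧸ I) ⧸ q) :=
    .of_surjective (Ideal.Quotient.mkₐ A q) Ideal.Quotient.mk_surjective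
  have hrho : IsRho (s.1 p).1 (integralClosure A ((∀ p, R p) ⧸ I) ⧸ q) := by
    refine .of_isIntegral
      ((IsPointwiseRealClosed.pi_quotient I).isRealClosed_quotient hA hbaer hI q)
      (fun a => ?_) fun a ha => ?_
    · rw [s.mem_supp_iff, ← hmem]
      exact Ideal.Quotient.eq_zero_iff_mem
    · obtain ⟨e, he, hep, h⟩ := (s.mem_iff hA hbaer hR I hI).1 ha
      have h1 := h.map (Ideal.Quotient.mk q)
      have h2 : 1 - e ∈ p.asIdeal := by
        refine (p.2.mem_or_mem (x := e) ?_).resolve_left hep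
        rw [mul_sub, mul_one, he, sub_self]
        exact p.asIdeal.zero_mem
      rw [← hmem] at h2
      have h3 : algebraMap A (integralClosure A ((∀ p, R p) ⧸ I) ⧸ q) a =
          Ideal.Quotient.mk q (algebraMap A _ (e * a)) := by
        refine (Ideal.Quotient.eq (I := q)
          (x := algebraMap A (integralClosure A ((∀ p, R p) ⧸ I)) a)).2 ?_
        rw [← map_sub, show a - e * a = (1 - e) * a by ring, map_mul]
        exact q.mul_mem_right _ h2
      rwa [h3]
  obtain ⟨φ⟩ := hrho.nonempty_algEquiv hR'
  exact ⟨φ.toAlgHom.comp (Ideal.Quotient.mkₐ A q)⟩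

/-- The map from `C` to the quotient of the product is injective because `C` is essential over `A`,
and lands in the integral closure. This is an integral essential real extension of `C`, so real
closedness `*` of `C` makes it an isomorphism. -/
theorem SuppSection.nonempty_algEquiv_integralClosure (hA : IsVonNeumannRegular A)
    (hbaer : IsBaerRing A) (s : SuppSection A) (hR : ∀ p, IsRho (s.1 p).1 (R p))
    (I : Ideal (∀ p, R p)) (hI : IsEssentialExtension A ((∀ p, R p) ⧸ I))
    {C : Type u} [CommRing C] [Algebra A C]
    (hC : IsRealClosureStar A C) (hhom : ∀ p, Nonempty (C →ₐ[A] R p)) :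
    Nonempty (C ≃ₐ[A] integralClosure A ((∀ p, R p) ⧸ I)) := by
  have hD := s.isRealClosureStar_integralClosure hA hbaer hR I hI
  have hintegral := hC.2.1
  have hreal := hD.1.1
  let φ : C →ₐ[A] (∀ p, R p) := AlgHom.pi fun p => (hhom p).some
  let ψ : C →ₐ[A] ((∀ p, R p) ⧸ I) := (Ideal.Quotient.mkₐ A I).comp φ
  have hψ : Function.Injective ψ := by
    rw [← AlgHom.coe_toRingHom, RingHom.injective_iff_ker_eq_bot]
    by_contra hne
    refine hC.2.2.1.2 _ hne ((Submodule.eq_bot_iff _).2 fun a ha => hI.1 ?_)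
    rw [map_zero, ← ψ.commutes a]
    exact ha
  let χ : C →ₐ[A] integralClosure A ((∀ p, R p) ⧸ I) :=
    ψ.codRestrict _ fun c => (Algebra.IsIntegral.isIntegral c).map ψ
  have hχ : Function.Injective χ := fun x y h => hψ (congrArg Subtype.val h)
  let _ : Algebra C (integralClosure A ((∀ p, R p) ⧸ I)) := χ.toRingHom.toAlgebra
  have : IsScalarTower A C (integralClosure A ((∀ p, R p) ⧸ I)) :=
    .of_algebraMap_eq fun a => (χ.commutes a).symm
  have hess : IsEssentialExtension C (integralClosure A ((∀ p, R p) ⧸ I)) := by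
    refine ⟨hχ, fun J hJ hbot => hD.2.2.1.2 J hJ ?_⟩
    rw [IsScalarTower.algebraMap_eq A C, ← Ideal.comap_comap, hbot, ← RingHom.ker_eq_comap_bot]
    exact (RingHom.injective_iff_ker_eq_bot _).1 hC.2.2.1.1
  have hsurj := hC.1.2 _ hreal hess (.tower_top A)
  exact ⟨AlgEquiv.ofBijective χ ⟨hχ, hsurj⟩⟩

end Sections

/-! ### From a real closure `*` to a continuous section, and the bijection. -/

section Classification

variable {A : Type u} [CommRing A] [PartialOrder A]

/-- Every real closure `*` maps to the fields `ρ(s(p))` of a suitable section `s`. -/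
theorem IsRealClosureStar.exists_suppSection (hA : IsVonNeumannRegular A) (hbaer : IsBaerRing A)
    {C : Type u} [CommRing C] [Algebra A C] (hC : IsRealClosureStar A C) :
    ∃ (s : SuppSection A) (R : PrimeSpectrum A → Type u) (_ : ∀ p, Field (R p))
      (_ : ∀ p, Algebra A (R p)), (∀ p, IsRho (s.1 p).1 (R p)) ∧
        ∀ p, Nonempty (C →ₐ[A] R p) := by
  obtain ⟨⟨hreal, -⟩, hintegral, hess, _, hpo, hpos⟩ := hC
  have hCreg : IsVonNeumannRegular C := hA.of_isIntegral
  obtain ⟨T, hT₀, hT⟩ := (RingCone.nonneg C).exists_maximal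
  have hsq : ∀ x : C, x * x ∈ T := fun x => hT₀ (IsPoring.mul_self_nonneg x)
  have htot := RingCone.exists_isIdempotentElem_of_maximal hA hCreg hbaer hess hsq hT
  have hover : ∀ p : PrimeSpectrum A, ∃ q : PrimeSpectrum C,
      q.asIdeal.comap (algebraMap A C) = p.asIdeal := by
    intro p
    obtain ⟨q, -, hq, hqp⟩ := Ideal.exists_ideal_over_prime_of_isIntegral (S := C) p.asIdeal ⊥
      (by rw [← RingHom.ker_eq_comap_bot, (RingHom.injective_iff_ker_eq_bot _).1 hess.1]
          exact bot_le)
    exact ⟨⟨q, hq⟩, hqp⟩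
  choose q hq using hover
  have hqmem : ∀ p (a : A), algebraMap A C a ∈ (q p).asIdeal ↔ a ∈ p.asIdeal := fun p a => by
    rw [← hq p, Ideal.mem_comap]
  choose t htsupp htmem using fun p =>
    RingCone.exists_primeCone hCreg hbaer hess hsq htot (q p)
  have hmax : ∀ p, (t p).supp.asIdeal.IsMaximal := fun p => hCreg.isMaximal _
  choose R hF hAlg hR using fun p => IsRho.exists_isRho (t p)
  have hsupp : ∀ p, (PrimeCone.comap (algebraMap A C) (t p)).supp = p := by
    refine fun p => PrimeSpectrum.ext (Ideal.ext fun a => ?_)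
    rw [← hqmem p, ← htsupp p, PrimeCone.mem_supp, PrimeCone.mem_supp, PrimeCone.mem_comap,
      PrimeCone.mem_comap, map_neg]
  let s : PrimeSpectrum A → Sper A := fun p =>
    ⟨PrimeCone.comap (algebraMap A C) (t p), fun a ha => (htmem p _).2
      ⟨1, .one, by rw [hqmem]; exact (Ideal.ne_top_iff_one _).1 p.2.ne_top, by
        rw [map_one, one_mul]
        exact hT₀ (hpos a ha)⟩⟩
  have hcont : Continuous s := by
    refine continuous_induced_rng.2 (continuous_generateFrom_iff.2 ?_)
    rintro _ ⟨x, rfl⟩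
    rw [isOpen_iff_forall_mem_open]
    rintro p ⟨hx, hxp⟩
    obtain ⟨e, he, hep, hex⟩ := (htmem p _).1 hx
    -- The witness `e` lies in `A` and `T` is global, so the same `e` works at every nearby prime,
    -- whichever prime `q p'` of `C` was chosen above it.
    refine ⟨PrimeSpectrum.basicOpen e ⊓ PrimeSpectrum.basicOpen x, ?_,
      (PrimeSpectrum.basicOpen e ⊓ PrimeSpectrum.basicOpen x).2, ?_⟩
    · rintro p' ⟨he', hx'⟩
      refine ⟨(htmem p' _).2 ⟨e, he, by rw [hqmem]; exact he', hex⟩, ?_⟩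
      change x ∉ (PrimeCone.comap (algebraMap A C) (t p')).supp.asIdeal
      rw [hsupp]
      exact hx'
    · refine ⟨by rwa [hqmem] at hep, ?_⟩
      change x ∉ (PrimeCone.comap (algebraMap A C) (t p)).supp.asIdeal at hxp
      rw [hsupp] at hxp
      exact hxp
  let _ : ∀ p, Algebra A (R p) := fun p =>
    ((algebraMap C (R p)).comp (algebraMap A C)).toAlgebra
  have htower : ∀ p, IsScalarTower A C (R p) := fun p => .of_algebraMap_eq' rfl
  refine ⟨⟨s, hcont, hsupp⟩, R, hF, inferInstance, fun p => ?_,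
    fun p => ⟨IsScalarTower.toAlgHom A C (R p)⟩⟩
  -- The real closure of `C` at `t p` is integral over `A` as well, so it also serves as `ρ(s(p))`.
  have := (hR p).isIntegral
  have : Algebra.IsIntegral A (R p) := .trans C
  refine .of_isIntegral (hR p).isRealClosed (fun a => ?_) fun a ha => (hR p).isSquare _ ha
  change _ ↔ a ∈ (PrimeCone.comap (algebraMap A C) (t p)).supp.asIdeal
  rw [hsupp, ← hqmem, ← htsupp p]
  exact (hR p).algebraMap_eq_zero_iff

end Classification

theorem mainTheorem1 {A : Type u} [CommRing A] [PartialOrder A] [IsPoring A]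
    (hreal : IsFormallyReal A) (hreg : IsVonNeumannRegular A) (hbaer : IsBaerRing A) :
    ∃ Φ : SuppSection A ≃ RealClosureStarClasses A,
      ∀ s : SuppSection A,
        -- the fields `ρ(s(p))` exist
        (∃ (R : PrimeSpectrum A → Type u) (_ : ∀ p, Field (R p)) (_ : ∀ p, Algebra A (R p)),
          ∀ p, IsRho (s.1 p).1 (R p)) ∧
        -- for any choice of them, `Φ(s)` is obtained from quotients of their product
        ∀ (R : PrimeSpectrum A → Type u) [∀ p, Field (R p)] [∀ p, Algebra A (R p)],
          (∀ p, IsRho (s.1 p).1 (R p)) →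
          Function.Injective (algebraMap A (∀ p, R p)) ∧
          (∃ I : Ideal (∀ p, R p),
            vanishingIdealOver (∀ p, R p) (Set.range fun p => (s.1 p).1) ≤ I ∧
            IsEssentialExtension A ((∀ p, R p) ⧸ I)) ∧
          ∀ I : Ideal (∀ p, R p),
            vanishingIdealOver (∀ p, R p) (Set.range fun p => (s.1 p).1) ≤ I →
            IsEssentialExtension A ((∀ p, R p) ⧸ I) →
            ∃ h : IsRealClosureStar A (integralClosure A ((∀ p, R p) ⧸ I)),
              Φ s = (Quotient.mk _ ⟨integralClosure A ((∀ p, R p) ⧸ I), h⟩ :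
                RealClosureStarClasses A) := by
  have hrho : ∀ s : SuppSection A,
      ∃ (R : PrimeSpectrum A → Type u) (_ : ∀ p, Field (R p)) (_ : ∀ p, Algebra A (R p)),
        ∀ p, IsRho (s.1 p).1 (R p) := by
    intro s
    have := s.isMaximal_supp hreg
    choose R hF hAlg hR using fun p => IsRho.exists_isRho (s.1 p).1
    exact ⟨R, hF, hAlg, hR⟩
  choose R hF hAlg hR using hrho
  choose I hI using fun s : SuppSection A =>
    exists_isEssentialExtension_quotient (s.injective_algebraMap (hR s))
  have hD := fun s : SuppSection A =>
    s.isRealClosureStar_integralClosure hreg hbaer (hR s) (I s) (hI s)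
  let Φ : SuppSection A → RealClosureStarClasses A := fun s => Quotient.mk _ ⟨_, hD s⟩
  -- The class does not depend on the chosen fields or on the chosen ideal.
  have hΦ : ∀ (s : SuppSection A) (R' : PrimeSpectrum A → Type u) [∀ p, Field (R' p)]
      [∀ p, Algebra A (R' p)] (hR' : ∀ p, IsRho (s.1 p).1 (R' p)) (I' : Ideal (∀ p, R' p))
      (hI' : IsEssentialExtension A ((∀ p, R' p) ⧸ I')),
      Φ s = Quotient.mk _ ⟨integralClosure A ((∀ p, R' p) ⧸ I'),
        s.isRealClosureStar_integralClosure hreg hbaer hR' I' hI'⟩ := by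
    intro s R' _ _ hR' I' hI'
    exact Quotient.sound (s.nonempty_algEquiv_integralClosure hreg hbaer hR' I' hI' (hD s)
      fun p => s.nonempty_algHom hreg hbaer (hR s) (I s) (hI s) (hR' p))
  have hinj : Function.Injective Φ := by
    intro s s' h
    obtain ⟨φ⟩ : Nonempty (integralClosure A ((∀ p, R s p) ⧸ I s) ≃ₐ[A]
      integralClosure A ((∀ p, R s' p) ⧸ I s')) := Quotient.exact h
    refine Subtype.ext (funext fun p => Subtype.ext ?_)
    refine PrimeCone.mem_of_le_of_supp_eq (fun a ha => ?_) (by rw [s.2.2, s'.2.2])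
    rw [s.mem_iff hreg hbaer (hR s) (I s) (hI s)] at ha
    rw [s'.mem_iff hreg hbaer (hR s') (I s') (hI s')]
    obtain ⟨e, he, hep, hsq⟩ := ha
    exact ⟨e, he, hep, by simpa only [φ.commutes] using hsq.map φ⟩
  have hsurj : Function.Surjective Φ := by
    intro c
    induction c using Quotient.inductionOn with
    | _ C =>
      obtain ⟨s, R', _, _, hR', hhom⟩ :=
        C.isRealClosureStar.exists_suppSection hreg hbaer
      obtain ⟨I', hI'⟩ := exists_isEssentialExtension_quotient (s.injective_algebraMap hR')
      refine ⟨s, (hΦ s R' hR' I' hI').trans (Quotient.sound ?_)⟩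
      obtain ⟨φ⟩ := s.nonempty_algEquiv_integralClosure hreg hbaer hR' I' hI'
        C.isRealClosureStar hhom
      exact ⟨φ.symm⟩
  refine ⟨Equiv.ofBijective Φ ⟨hinj, hsurj⟩, fun s => ⟨⟨R s, hF s, hAlg s, hR s⟩, ?_⟩⟩
  intro R' _ _ hR'
  refine ⟨s.injective_algebraMap hR', ?_, fun I' _ hI' => ⟨_, hΦ s R' hR' I' hI'⟩⟩
  obtain ⟨I', hI'⟩ := exists_isEssentialExtension_quotient (s.injective_algebraMap hR')
  refine ⟨I', ?_, hI'⟩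
  rw [vanishingIdealOver_eq_bot hR']
  exact bot_le
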